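/- Biclique-Free Vertex Deletion is the following decision problem. Given a finite simple undirected graph $G$ and positive integers $i,j,k$ with $i\le j$ (all part of the input), decide whether there is a set $V'\subseteq V(G)$ with $|V'|\le k$ such that $G-V'$ does not contain the complete bipartite graph $K_{i,j}$ as a (not necessarily induced) subgraph. Let $n=|V(G)|$, and let $d$ be the degeneracy of $G$, that is, the least integer $d\ge 0$ such that every nonempty induced subgraph of $G$ has a vertex of degree at most $d$ in that subgraph. Running time is measured in steps of a unit-cost random access machine with addition, truncated subtraction and comparison of natural numbers, whose input consists of $n,i,j,k$ (one register each) and the adjacency matrix of $G$. Then Biclique-Free Vertex Deletion can be solved in time $2^{O(dk^2)}\cdot n^{O(1)}$: there are a single program and constants $A,C,c\in\mathbb N$ such that on every instance the program halts with the correct answer after at most $A\cdot 2^{C d k^2}\cdot (n+1)^{c}$ steps. Consequently, the problem is fixed-parameter tractable with respect to $k+d$: it is solved by a program in at most $f(k+d)\cdot (n+1)^{c}$ steps, for some computable function $f\colon\mathbb N\to\mathbb N$ and some constant $c$. -/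

import Mathlib

/-! ### Graph notions -/

namespace BFVD

/-- `G` is `d`-degenerate: every nonempty induced subgraph `G[S]` has a vertex whose degree
inside `G[S]` is at most `d`. -/
def IsDegenerate {V : Type*} (G : SimpleGraph V) (d : ℕ) : Prop :=
  ∀ S : Finset V, S.Nonempty → ∃ v ∈ S, (G.neighborSet v ∩ (S : Set V)).ncard ≤ d

/-- The degeneracy of a finite graph: the least `d` such that `G` is `d`-degenerate. -/
noncomputable def degeneracy {V : Type*} [Finite V] (G : SimpleGraph V) : ℕ :=
  sInf {d : ℕ | IsDegenerate G d}

/-- `(G, i, j, k)` is a yes-instance of Biclique-Free Vertex Deletion: at most `k` vertices can be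
deleted from `G` so that the remaining graph contains no `K_{i,j}` as a (not necessarily induced)
subgraph. -/
def IsYesInstance {V : Type*} (G : SimpleGraph V) (i j k : ℕ) : Prop :=
  ∃ D : Finset V, D.card ≤ k ∧
    (completeBipartiteGraph (Fin i) (Fin j)).Free (G.induce ((D : Set V)ᶜ))

end BFVD

/-! ### The machine model: a unit-cost random access machine

The machine has registers and arrays (memories with indirect addressing) that hold natural numbers.
The arithmetic consists of addition, truncated subtraction and comparison. There is no
multiplication, so that unit cost is polynomially equivalent to logarithmic cost and to Turing
machine time. -/

namespace RAM

/-- A configuration of the memory: the contents of register `x` is `reg x`, and the contents of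
cell `y` of array `a` is `mem a y`. -/
@[ext] structure State where
  reg : ℕ → ℕ
  mem : ℕ → ℕ → ℕ

/-- Arithmetic expressions over the current memory. -/
inductive Expr where
  /-- a constant -/
  | const (c : ℕ)
  /-- the contents of register `x` -/
  | reg (x : ℕ)
  /-- the contents of the cell of array `a` whose address is the value of `e` -/
  | get (a : ℕ) (e : Expr)
  /-- addition -/
  | add (e₁ e₂ : Expr)
  /-- truncated subtraction -/
  | sub (e₁ e₂ : Expr)
  /-- comparison: `1` if the value of `e₁` is smaller than that of `e₂`, otherwise `0` -/
  | lt (e₁ e₂ : Expr)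

/-- The value of an expression. -/
def Expr.eval (σ : State) : Expr → ℕ
  | .const c => c
  | .reg x => σ.reg x
  | .get a e => σ.mem a (e.eval σ)
  | .add e₁ e₂ => e₁.eval σ + e₂.eval σ
  | .sub e₁ e₂ => e₁.eval σ - e₂.eval σ
  | .lt e₁ e₂ => if e₁.eval σ < e₂.eval σ then 1 else 0

/-- The number of steps that evaluating an expression takes: one for each of its nodes. -/
def Expr.cost : Expr → ℕ
  | .const _ => 1
  | .reg _ => 1
  | .get _ e => e.cost + 1
  | .add e₁ e₂ => e₁.cost + e₂.cost + 1
  | .sub e₁ e₂ => e₁.cost + e₂.cost + 1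
  | .lt e₁ e₂ => e₁.cost + e₂.cost + 1

/-- Programs. A test `e` succeeds if its value is nonzero. -/
inductive Program where
  | skip
  /-- write the value of `e` into register `x` -/
  | assign (x : ℕ) (e : Expr)
  /-- write the value of `e` into the cell of array `a` whose address is the value of `y` -/
  | store (a : ℕ) (y e : Expr)
  | seq (p q : Program)
  | ite (e : Expr) (p q : Program)
  | loop (e : Expr) (p : Program)

/-- `Exec p σ τ t`: started in the memory configuration `σ`, the program `p` halts after exactly
`t` steps, in the memory configuration `τ`. Here `Program.loop e p` is "while `e` do `p`". -/
inductive Exec : Program → State → State → ℕ → Prop where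
  | skip (σ : State) : Exec .skip σ σ 1
  | assign (σ : State) (x : ℕ) (e : Expr) :
      Exec (.assign x e) σ ⟨Function.update σ.reg x (e.eval σ), σ.mem⟩ (e.cost + 1)
  | store (σ : State) (a : ℕ) (y e : Expr) :
      Exec (.store a y e) σ
        ⟨σ.reg, Function.update σ.mem a (Function.update (σ.mem a) (y.eval σ) (e.eval σ))⟩
        (y.cost + e.cost + 1)
  | seq {p q : Program} {σ τ ρ : State} {s t : ℕ} :
      Exec p σ τ s → Exec q τ ρ t → Exec (.seq p q) σ ρ (s + t)
  | ite_true {e : Expr} {p : Program} (q : Program) {σ τ : State} {t : ℕ} :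
      e.eval σ ≠ 0 → Exec p σ τ t → Exec (.ite e p q) σ τ (e.cost + 1 + t)
  | ite_false {e : Expr} (p : Program) {q : Program} {σ τ : State} {t : ℕ} :
      e.eval σ = 0 → Exec q σ τ t → Exec (.ite e p q) σ τ (e.cost + 1 + t)
  | loop_done {e : Expr} (p : Program) {σ : State} :
      e.eval σ = 0 → Exec (.loop e p) σ σ (e.cost + 1)
  | loop_step {e : Expr} {p : Program} {σ τ ρ : State} {s t : ℕ} :
      e.eval σ ≠ 0 → Exec p σ τ s → Exec (.loop e p) τ ρ t →
        Exec (.loop e p) σ ρ (e.cost + 1 + s + t)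

end RAM

namespace BFVD

open Classical in
/-- The initial memory for the instance `(G, i, j, k)`, where `G` has the vertices `0, …, n - 1`:
registers `0, 1, 2, 3` hold `n, i, j, k`, array `0` holds the adjacency matrix of `G` row by row
(the entry for `(u, v)` is in cell `u * n + v`), and everything else is `0`. -/
noncomputable def input {n : ℕ} (G : SimpleGraph (Fin n)) (i j k : ℕ) : RAM.State where
  reg x := if x = 0 then n else if x = 1 then i else if x = 2 then j else if x = 3 then k else 0
  mem a y := if a = 0 ∧ ∃ u v : Fin n, G.Adj u v ∧ y = (u : ℕ) * n + (v : ℕ) then 1 else 0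

open Classical in
/-- The program `p` solves Biclique-Free Vertex Deletion within the time bound `T`: on every
instance `(G, i, j, k)` with positive integers `i ≤ j` and `k` it halts after at most `T G i j k`
steps and leaves the answer (`1` for yes, `0` for no) in register `0`. -/
def SolvesInTime (p : RAM.Program)
    (T : {n : ℕ} → SimpleGraph (Fin n) → (i j k : ℕ) → ℕ) : Prop :=
  ∀ (n : ℕ) (G : SimpleGraph (Fin n)) (i j k : ℕ), 1 ≤ i → i ≤ j → 1 ≤ k →
    ∃ (τ : RAM.State) (t : ℕ), RAM.Exec p (input G i j k) τ t ∧ t ≤ T G i j k ∧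
      τ.reg 0 = if IsYesInstance G i j k then 1 else 0

end BFVD

/-!
The algorithm is a search tree of depth `k` with `2 ^ O(d * k)` children per node. The vertices are
ordered by repeatedly removing a vertex of small degree (`BFVD.Peel`), so that each vertex has at
most `d` later neighbours. The first vertex of a biclique `K_{i,j}` has the opposite side among its
later neighbours. Hence all bicliques are found by going through the `2 ^ d` sets of later
neighbours of every vertex and counting their common neighbours; call such a set bad if it is a
side of a biclique (`BFVD.Inst.Bad`, `BFVD.Inst.Biclique.exists_bad`).

In a node of the search tree, a greedy union `X` of bad sets is formed, stopped as soon as it has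
more than `k * d` elements (`BFVD.Inst.core`). It is empty if and only if no biclique is left. A
solution that contains neither a vertex of `X` nor a later neighbour of one meets the common
neighbourhood of every bad set in `X`, and does so in vertices that come before the bad set. So `X`
consists of later neighbours of the solution and has at most `k * d` elements. Then `X` contains
all bad sets, so that only the neighbourhoods in `X` of the solution vertices matter, and each
solution vertex may be exchanged for the first vertex with the same neighbourhood in `X`. Therefore
it suffices to branch on the elements of `X`, their later neighbours, and one vertex for each of
the at most `2 ^ #X` neighbourhoods in `X` (`BFVD.Inst.Yes.exists_branch`,
`BFVD.Inst.card_branch_core_le`). The paths of the search tree are encoded by the numbers below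
`base ^ k`, where `base = 2 ^ (6 * d * k)`, and the program follows them one after the other
(`BFVD.Inst.exists_run_iff`).

The program is written in a language `RAM.FP` whose only loops are counting loops with fixed
bounds. Such programs have a total semantics `RAM.FP.sem`, about which loop invariants are proved
by `RAM.FP.sem_loop`, and their running time is at most a constant times a power of the largest
loop bound (`RAM.FP.runsIn`). All loop bounds that occur are in `O(2 ^ (6 * d * k ^ 2) * (n + 1))`,
so that the running time is as claimed.
-/

/-! ### Programs with counting loops -/

namespace RAM

/-- The memory `σ` with `v` written into register `x`. -/
def State.set (σ : State) (x v : ℕ) : State := ⟨Function.update σ.reg x v, σ.mem⟩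

/-- The memory `σ` with `v` written into cell `y` of array `a`. -/
def State.put (σ : State) (a y v : ℕ) : State :=
  ⟨σ.reg, Function.update σ.mem a (Function.update (σ.mem a) y v)⟩

@[simp] theorem State.set_reg (σ : State) (x v r : ℕ) :
    (σ.set x v).reg r = if r = x then v else σ.reg r := by
  simp [State.set, Function.update_apply]

@[simp] theorem State.set_mem (σ : State) (x v : ℕ) : (σ.set x v).mem = σ.mem := rfl

@[simp] theorem State.put_reg (σ : State) (a y v : ℕ) : (σ.put a y v).reg = σ.reg := rfl

theorem State.put_mem (σ : State) (a y v b : ℕ) :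
    (σ.put a y v).mem b = if b = a then Function.update (σ.mem a) y v else σ.mem b := by
  simp [State.put, Function.update_apply]

@[simp] theorem State.put_mem_apply (σ : State) (a y v b z : ℕ) :
    (σ.put a y v).mem b z = if b = a ∧ z = y then v else σ.mem b z := by
  rw [State.put_mem]
  by_cases h : b = a <;> simp [h, Function.update_apply]

/-- Programs whose only loops are counting loops. `loop x b p` runs `p` for the values
`0, 1, …, N - 1` of register `x`, where `N` is the contents of register `b`. -/
inductive FP where
  | skip
  | assign (x : ℕ) (e : Expr)
  | store (a : ℕ) (y e : Expr)
  | seq (p q : FP)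
  | ite (e : Expr) (p q : FP)
  | loop (x b : ℕ) (p : FP)

namespace FP

/-- The translation into programs of the machine. -/
def compile : FP → Program
  | skip => .skip
  | assign x e => .assign x e
  | store a y e => .store a y e
  | seq p q => .seq p.compile q.compile
  | ite e p q => .ite e p.compile q.compile
  | loop x b p => .seq (.assign x (.const 0)) (.loop (.lt (.reg x) (.reg b))
      (.seq p.compile (.assign x (.add (.reg x) (.const 1)))))

/-- The memory after `m` rounds of a loop with counter `x` whose body acts as `f`. -/
def rounds (f : State → State) (x : ℕ) (σ : State) : ℕ → State
  | 0 => σ.set x 0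
  | m + 1 => (f (rounds f x σ m)).set x (m + 1)

/-- The effect of a program on the memory. -/
def sem : FP → State → State
  | skip, σ => σ
  | assign x e, σ => σ.set x (e.eval σ)
  | store a y e, σ => σ.put a (y.eval σ) (e.eval σ)
  | seq p q, σ => q.sem (p.sem σ)
  | ite e p q, σ => if e.eval σ ≠ 0 then p.sem σ else q.sem σ
  | loop x b p, σ => rounds p.sem x σ (σ.reg b)

theorem sem_seq (p q : FP) (σ : State) : (seq p q).sem σ = q.sem (p.sem σ) := rfl

theorem sem_assign (x : ℕ) (e : Expr) (σ : State) : (assign x e).sem σ = σ.set x (e.eval σ) := rfl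

/-- Whether register `r` is written anywhere in the program. -/
def wr : FP → ℕ → Bool
  | skip, _ => false
  | assign x _, r => r == x
  | store _ _ _, _ => false
  | seq p q, r => p.wr r || q.wr r
  | ite _ p q, r => p.wr r || q.wr r
  | loop x _ p, r => r == x || p.wr r

/-- Whether array `a` is written anywhere in the program. -/
def wm : FP → ℕ → Bool
  | skip, _ => false
  | assign _ _, _ => false
  | store a _ _, r => r == a
  | seq p q, r => p.wm r || q.wm r
  | ite _ p q, r => p.wm r || q.wm r
  | loop _ _ p, r => p.wm r

/-- The registers that bound the loops of the program. -/
def bounds : FP → List ℕ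
  | skip => []
  | assign _ _ => []
  | store _ _ _ => []
  | seq p q => p.bounds ++ q.bounds
  | ite _ p q => p.bounds ++ q.bounds
  | loop _ b p => b :: p.bounds

/-- No loop body writes the counter of its loop. -/
def countersOk : FP → Bool
  | skip => true
  | assign _ _ => true
  | store _ _ _ => true
  | seq p q => p.countersOk && q.countersOk
  | ite _ p q => p.countersOk && q.countersOk
  | loop x _ p => !p.wr x && p.countersOk

/-- No loop body writes the counter of its loop, and the program leaves alone all registers that
bound its loops. -/
def ok (p : FP) : Bool := p.countersOk && p.bounds.all fun b => !p.wr b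

/-- The nesting depth of the loops. -/
def depth : FP → ℕ
  | skip => 0
  | assign _ _ => 0
  | store _ _ _ => 0
  | seq p q => max p.depth q.depth
  | ite _ p q => max p.depth q.depth
  | loop _ _ p => p.depth + 1

/-- A measure of the length of the program, for the time bound `FP.runsIn`. -/
def size : FP → ℕ
  | skip => 1
  | assign _ e => e.cost + 1
  | store _ y e => y.cost + e.cost + 1
  | seq p q => p.size + q.size
  | ite e p q => e.cost + 1 + p.size + q.size
  | loop _ _ p => p.size + 8

/-- `ρ` arises from `σ` by changing only registers and arrays that `p` writes. -/
structure Frame (p : FP) (σ ρ : State) : Prop where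
  reg : ∀ r, p.wr r = false → ρ.reg r = σ.reg r
  mem : ∀ a, p.wm a = false → ρ.mem a = σ.mem a

theorem frame_rounds_of {p : FP} (b x : ℕ) (hp : ∀ σ, Frame p σ (p.sem σ)) (σ : State) (m : ℕ) :
    Frame (loop x b p) σ (rounds p.sem x σ m) := by
  induction m with
  | zero => exact ⟨fun r h => by simp_all [rounds, wr], fun _ _ => rfl⟩
  | succ m ihm =>
    constructor
    · intro r h
      have h' := h
      simp only [wr, Bool.or_eq_false_iff, beq_eq_false_iff_ne] at h'
      rw [rounds, State.set_reg, if_neg h'.1, (hp _).reg r h'.2, ihm.reg r h]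
    · intro r h
      rw [rounds, State.set_mem, (hp _).mem r h, ihm.mem r h]

theorem frame_sem (p : FP) (σ : State) : Frame p σ (p.sem σ) := by
  induction p generalizing σ with
  | skip => exact ⟨fun _ _ => rfl, fun _ _ => rfl⟩
  | assign x e => exact ⟨fun r h => by simp_all [sem, wr], fun _ _ => rfl⟩
  | store a y e => exact ⟨fun _ _ => rfl, fun r h => by simp_all [sem, wm, State.put_mem]⟩
  | seq p q ihp ihq =>
    constructor
    · intro r h
      simp only [wr, Bool.or_eq_false_iff] at h
      rw [sem, (ihq _).reg r h.2, (ihp _).reg r h.1]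
    · intro r h
      simp only [wm, Bool.or_eq_false_iff] at h
      rw [sem, (ihq _).mem r h.2, (ihp _).mem r h.1]
  | ite e p q ihp ihq =>
    constructor
    · intro r h
      simp only [wr, Bool.or_eq_false_iff] at h
      rw [sem]
      split_ifs
      exacts [(ihp _).reg r h.1, (ihq _).reg r h.2]
    · intro r h
      simp only [wm, Bool.or_eq_false_iff] at h
      rw [sem]
      split_ifs
      exacts [(ihp _).mem r h.1, (ihq _).mem r h.2]
  | loop x b p ih =>
    exact frame_rounds_of b x ih σ _

theorem frame_rounds (x b : ℕ) (p : FP) (σ : State) (m : ℕ) :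
    Frame (loop x b p) σ (rounds p.sem x σ m) :=
  frame_rounds_of b x (frame_sem p) σ m

theorem rounds_reg (f : State → State) (x : ℕ) (σ : State) (m : ℕ) :
    (rounds f x σ m).reg x = m := by
  cases m <;> simp [rounds]

/-- The invariant rule for counting loops. The frame conditions come for free. -/
theorem sem_loop (I : ℕ → State → Prop) {x b : ℕ} {p : FP} {σ : State}
    (h0 : I 0 (σ.set x 0))
    (hs : ∀ m ρ, m < σ.reg b → ρ.reg x = m → Frame (loop x b p) σ ρ → I m ρ →
      I (m + 1) ((p.sem ρ).set x (m + 1))) :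
    I (σ.reg b) ((loop x b p).sem σ) := by
  have key : ∀ m, m ≤ σ.reg b → I m (rounds p.sem x σ m) := by
    intro m
    induction m with
    | zero => intro _; exact h0
    | succ m ih =>
      intro hm
      exact hs m _ hm (rounds_reg _ _ _ _) (frame_rounds _ _ _ _ _) (ih (by omega))
  exact key _ le_rfl

/-- Started in `σ`, the program halts within a number of steps that is polynomial in `N`, the degree
being the nesting depth of its loops. -/
def RunsIn (p : FP) (N : ℕ) (σ : State) : Prop :=
  ∃ t, t ≤ p.size * N ^ p.depth ∧ Exec p.compile σ (p.sem σ) t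

theorem size_mul_pow_le (p : FP) {N e : ℕ} (hN : 1 ≤ N) (h : p.depth ≤ e) :
    p.size * N ^ p.depth ≤ p.size * N ^ e :=
  Nat.mul_le_mul_left _ (Nat.pow_le_pow_right hN h)

theorem RunsIn.seq {p q : FP} {N : ℕ} (hN : 1 ≤ N) {σ : State} (hp : p.RunsIn N σ)
    (hq : q.RunsIn N (p.sem σ)) : (FP.seq p q).RunsIn N σ := by
  obtain ⟨s, hs, es⟩ := hp
  obtain ⟨t, ht, et⟩ := hq
  refine ⟨s + t, ?_, .seq es et⟩
  have h1 := size_mul_pow_le p hN (le_max_left p.depth q.depth)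
  have h2 := size_mul_pow_le q hN (le_max_right p.depth q.depth)
  simp only [size, depth, add_mul]
  omega

theorem runsIn_of_countersOk (p : FP) (N : ℕ) (hN : 1 ≤ N) (σ : State)
    (hc : p.countersOk = true) (hb : ∀ b ∈ p.bounds, p.wr b = false ∧ σ.reg b + 1 ≤ N) :
    p.RunsIn N σ := by
  induction p generalizing σ with
  | skip => exact ⟨1, by simp [size, depth], .skip σ⟩
  | assign x e => exact ⟨_, by simp [size, depth], .assign σ x e⟩
  | store a y e => exact ⟨_, by simp [size, depth], .store σ a y e⟩
  | seq p q ihp ihq =>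
    simp only [countersOk, Bool.and_eq_true] at hc
    simp only [bounds, List.mem_append, wr, Bool.or_eq_false_iff] at hb
    exact (ihp σ hc.1 fun b h => ⟨(hb b (.inl h)).1.1, (hb b (.inl h)).2⟩).seq hN
      (ihq (p.sem σ) hc.2 fun b h => ⟨(hb b (.inr h)).1.2, by
        rw [(frame_sem p σ).reg b (hb b (.inr h)).1.1]; exact (hb b (.inr h)).2⟩)
  | ite e p q ihp ihq =>
    simp only [countersOk, Bool.and_eq_true] at hc
    simp only [bounds, List.mem_append, wr, Bool.or_eq_false_iff] at hb
    have h1 := size_mul_pow_le p hN (le_max_left p.depth q.depth)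
    have h2 := size_mul_pow_le q hN (le_max_right p.depth q.depth)
    have h3 : e.cost + 1 ≤ (e.cost + 1) * N ^ max p.depth q.depth :=
      Nat.le_mul_of_pos_right _ (by positivity)
    by_cases he : e.eval σ = 0
    · obtain ⟨t, ht, et⟩ := ihq σ hc.2 fun b h => ⟨(hb b (.inr h)).1.2, (hb b (.inr h)).2⟩
      refine ⟨e.cost + 1 + t, ?_, ?_⟩
      · rw [size, depth, add_mul, add_mul]; omega
      · rw [sem, if_neg (by simpa using he)]; exact .ite_false _ he et
    · obtain ⟨t, ht, et⟩ := ihp σ hc.1 fun b h => ⟨(hb b (.inl h)).1.1, (hb b (.inl h)).2⟩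
      refine ⟨e.cost + 1 + t, ?_, ?_⟩
      · rw [size, depth, add_mul, add_mul]; omega
      · rw [sem, if_pos he]; exact .ite_true _ he et
  | loop x b p ih =>
    simp only [countersOk, Bool.and_eq_true, Bool.not_eq_true'] at hc
    have hbb := hb b (by simp [bounds])
    set T := p.size * N ^ p.depth with hT
    -- Run the remaining `r` rounds from the memory after `m` rounds.
    have key : ∀ r m, m + r = σ.reg b → ∃ t, t ≤ r * (T + 8) + 4 ∧
        Exec (.loop (.lt (.reg x) (.reg b))
          (.seq p.compile (.assign x (.add (.reg x) (.const 1)))))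
          (rounds p.sem x σ m) (rounds p.sem x σ (σ.reg b)) t := by
      intro r
      induction r with
      | zero =>
        intro m hm
        obtain rfl : m = σ.reg b := by omega
        refine ⟨4, by omega, ?_⟩
        refine Exec.loop_done _ ?_
        simp [Expr.eval, rounds_reg, (frame_rounds x b p σ (σ.reg b)).reg b hbb.1]
      | succ r ihr =>
        intro m hm
        obtain ⟨t, ht, et⟩ := ihr (m + 1) (by omega)
        have hF := frame_rounds x b p σ m
        obtain ⟨s, hs, es⟩ := ih (rounds p.sem x σ m) hc.2 fun c hcb => by
          have hcc := hb c (by simp [bounds, hcb])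
          refine ⟨?_, by rw [hF.reg c hcc.1]; exact hcc.2⟩
          have := hcc.1
          simp only [wr, Bool.or_eq_false_iff] at this
          exact this.2
        have ex : ((p.sem (rounds p.sem x σ m)).reg x) = m := by
          rw [(frame_sem p _).reg x hc.1, rounds_reg]
        have e2 := Exec.assign (p.sem (rounds p.sem x σ m)) x (.add (.reg x) (.const 1))
        have e3 : (⟨Function.update (p.sem (rounds p.sem x σ m)).reg x
            (Expr.eval (p.sem (rounds p.sem x σ m)) (.add (.reg x) (.const 1))),
            (p.sem (rounds p.sem x σ m)).mem⟩ : State) = rounds p.sem x σ (m + 1) := by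
          simp only [Expr.eval, ex]; rfl
        rw [e3] at e2
        refine ⟨_, ?_, Exec.loop_step ?_ (.seq es e2) et⟩
        · simp only [Expr.cost, add_mul, one_mul]; omega
        · have : m < σ.reg b := by omega
          simp [Expr.eval, rounds_reg, hF.reg b hbb.1, this]
    obtain ⟨t, ht, et⟩ := key (σ.reg b) 0 (by omega)
    refine ⟨2 + t, ?_, .seq (.assign σ x (.const 0)) et⟩
    have hP : 1 ≤ N ^ p.depth := Nat.one_le_pow _ _ hN
    calc 2 + t ≤ (σ.reg b + 1) * (T + 8) := by rw [add_mul]; omega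
      _ ≤ N * ((p.size + 8) * N ^ p.depth) := by
          refine Nat.mul_le_mul hbb.2 ?_
          rw [add_mul]; omega
      _ = _ := by rw [size, depth, pow_succ]; ring

/-- A program whose loop bounds are fixed halts within a number of steps that is polynomial in the
values of these bounds. -/
theorem runsIn {p : FP} (hp : p.ok = true) {N : ℕ} (hN : 1 ≤ N) {σ : State}
    (hb : ∀ b ∈ p.bounds, σ.reg b + 1 ≤ N) : p.RunsIn N σ := by
  simp only [ok, Bool.and_eq_true, List.all_eq_true, Bool.not_eq_true'] at hp
  exact runsIn_of_countersOk p N hN σ hp.1 fun b h => ⟨hp.2 b h, hb b h⟩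

end FP

namespace Expr

/-- Equality test. -/
def eq (a b : Expr) : Expr := .sub (.const 1) (.add (.sub a b) (.sub b a))
/-- Negation: the test that succeeds if `a` fails. -/
def not (a : Expr) : Expr := .sub (.const 1) a
/-- Conjunction of tests. -/
def and (a b : Expr) : Expr := .sub (.const 1) (.add a.not b.not)
/-- Disjunction of tests. -/
def or (a b : Expr) : Expr := .add a b
/-- The test that `a` is at most `b`. -/
def le (a b : Expr) : Expr := (Expr.lt b a).not

/-- The test `e` succeeds in the memory `σ`. -/
def Holds (e : Expr) (σ : State) : Prop := e.eval σ ≠ 0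

variable {σ : State} {a b : Expr}

@[simp] theorem holds_eq : (eq a b).Holds σ ↔ a.eval σ = b.eval σ := by
  simp only [Holds, eq, eval]; omega
@[simp] theorem holds_not : (not a).Holds σ ↔ ¬ a.Holds σ := by
  simp only [Holds, not, eval]; omega
@[simp] theorem holds_and : (and a b).Holds σ ↔ a.Holds σ ∧ b.Holds σ := by
  simp only [Holds, and, not, eval]; omega
@[simp] theorem holds_or : (or a b).Holds σ ↔ a.Holds σ ∨ b.Holds σ := by
  simp only [Holds, or, eval]; omega
@[simp] theorem holds_lt : (Expr.lt a b).Holds σ ↔ a.eval σ < b.eval σ := by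
  simp [Holds, eval]
@[simp] theorem holds_le : (le a b).Holds σ ↔ a.eval σ ≤ b.eval σ := by
  simp [le]

end Expr

namespace FP

open Classical in
theorem sem_ite (e : Expr) (p q : FP) (σ : State) :
    (ite e p q).sem σ = if e.Holds σ then p.sem σ else q.sem σ := by
  rw [sem]
  congr

/-- Count in register `c` the values of `x` below the contents of register `b` for which the test
`e` succeeds after running `p`. -/
def count (x b c : ℕ) (p : FP) (e : Expr) : FP :=
  seq (assign c (.const 0))
    (loop x b (seq p (ite e (assign c (.add (.reg c) (.const 1))) skip)))

/-- The test is examined in an arbitrary memory that differs from the initial one only in what the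
loop writes. -/
theorem sem_count {x b c : ℕ} {p : FP} {e : Expr} {σ : State} (P : ℕ → Prop)
    [DecidablePred P]
    (hcx : c ≠ x) (hcb : b ≠ c) (hp : p.wr c = false)
    (h : ∀ m ρ, m < σ.reg b → ρ.reg x = m → Frame (count x b c p e) σ ρ →
      (e.Holds (p.sem ρ) ↔ P m)) :
    ((count x b c p e).sem σ).reg c = Nat.count P (σ.reg b) := by
  have hb : (σ.set c 0).reg b = σ.reg b := by simp [hcb]
  have := sem_loop (x := x) (b := b)
    (p := seq p (ite e (assign c (.add (.reg c) (.const 1))) skip)) (σ := σ.set c 0)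
    (fun m ρ => ρ.reg c = Nat.count P m) (by simp [hcx]) (by
      intro m ρ hm hx hF hI
      have hF' : Frame (count x b c p e) σ ρ := by
        constructor
        · intro r hr
          simp only [count, wr, Bool.or_eq_false_iff, beq_eq_false_iff_ne] at hr
          rw [hF.reg r (by simp [wr, hr])]
          simp [hr]
        · intro r hr
          simp only [count, wm, Bool.or_eq_false_iff] at hr
          rw [hF.mem r (by simp [wm, hr])]
          rfl
      have hh := h m ρ (hb ▸ hm) hx hF'
      have hpc := (frame_sem p ρ).reg c hp
      rw [sem, sem_ite, Nat.count_succ]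
      by_cases hP : P m
      · rw [if_pos (hh.2 hP)]
        simp [sem, hcx, Expr.eval, hpc, hI, hP]
      · rw [if_neg (fun H => hP (hh.1 H))]
        simp [sem, hcx, hpc, hI, hP])
  rw [hb] at this
  exact this

/-- Fill the first cells of array `a` with zeros, as many as register `b` says. -/
def clear (x b a : ℕ) : FP := loop x b (store a (.reg x) (.const 0))

theorem sem_clear {x b a : ℕ} {σ : State} {v : ℕ} (hv : v < σ.reg b) :
    ((clear x b a).sem σ).mem a v = 0 := by
  have := sem_loop (x := x) (b := b) (p := store a (.reg x) (.const 0)) (σ := σ)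
    (fun m ρ => ∀ v < m, ρ.mem a v = 0) (by simp) (by
      intro m ρ hm hx hF hI v hv
      simp only [sem, State.set_mem, State.put_mem_apply, Expr.eval, hx, true_and]
      split_ifs with h
      · rfl
      · exact hI v (by omega))
  exact this v hv

/-- Division with remainder: register `z` is divided by `e`, which may not be zero. The remainder
is left in `z`, the quotient in `q`. The loop tries a subtraction as often as register `b` says;
this suffices if `z` is at most `b`. -/
def divMod (x b z q : ℕ) (e : Expr) : FP :=
  seq (assign q (.const 0))
    (loop x b (ite (Expr.le e (.reg z))
      (seq (assign z (.sub (.reg z) e)) (assign q (.add (.reg q) (.const 1)))) skip))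

/-- Powers are computed by loops whose body multiplies a register by a constant. -/
theorem sem_loop_mul {x b r : ℕ} {p : FP} {σ : State} (c : ℕ) (hr : r ≠ x)
    (h : ∀ ρ, Frame (loop x b p) σ ρ → (p.sem ρ).reg r = ρ.reg r * c) :
    ((loop x b p).sem σ).reg r = σ.reg r * c ^ σ.reg b :=
  sem_loop (fun m ρ => ρ.reg r = σ.reg r * c ^ m) (by simp [hr]) fun m ρ _ _ hF hI => by
    rw [State.set_reg, if_neg hr, h ρ hF, hI, pow_succ, mul_assoc]

theorem sem_divMod {x b z q : ℕ} {e : Expr} {σ : State} (d : ℕ) (hd : 0 < d)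
    (hxz : z ≠ x) (hxq : q ≠ x) (hzq : q ≠ z) (hbq : b ≠ q)
    (he : ∀ ρ, Frame (divMod x b z q e) σ ρ → e.eval ρ = d) (hz : σ.reg z ≤ σ.reg b) :
    ((divMod x b z q e).sem σ).reg z = σ.reg z % d ∧
      ((divMod x b z q e).sem σ).reg q = σ.reg z / d := by
  have hb : (σ.set q 0).reg b = σ.reg b := by simp [hbq]
  have := sem_loop (x := x) (b := b) (p := ite (Expr.le e (.reg z))
      (seq (assign z (.sub (.reg z) e)) (assign q (.add (.reg q) (.const 1)))) skip)
      (σ := σ.set q 0)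
    (fun m ρ => σ.reg z = ρ.reg z + d * ρ.reg q ∧ (ρ.reg z < d ∨ ρ.reg q = m))
    (by simp [hxz, hxq, hzq.symm]) (by
      rintro m ρ hm hx hF ⟨h1, h2⟩
      have hF' : Frame (divMod x b z q e) σ ρ := by
        constructor
        · intro r hr
          simp only [divMod, wr, Bool.or_eq_false_iff, beq_eq_false_iff_ne] at hr
          rw [hF.reg r (by simp [wr, hr])]
          simp [hr]
        · intro r hr
          rw [hF.mem r (by simp [wm])]
          rfl
      have hed := he ρ hF'
      rw [sem_ite]
      by_cases hle : d ≤ ρ.reg z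
      · rw [if_pos (by simpa [hed, Expr.eval] using hle)]
        simp only [sem, State.set_reg, Expr.eval, hed, if_neg hxz, if_neg hxq, if_neg hzq,
          if_neg hzq.symm, if_true]
        constructor
        · rw [mul_add, mul_one]; omega
        · omega
      · rw [if_neg (by simpa [hed, Expr.eval] using hle)]
        simp only [sem, State.set_reg, if_neg hxz, if_neg hxq]
        exact ⟨h1, by omega⟩)
  rw [hb] at this
  obtain ⟨h1, h2⟩ := this
  have hlt : ((divMod x b z q e).sem σ).reg z < d := by
    rcases h2 with h2 | h2
    · exact h2
    -- If every round subtracts and the rest is still not small, then `z` was larger than `b`.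
    · by_contra hcon
      have : σ.reg b ≤ d * σ.reg b := Nat.le_mul_of_pos_left _ hd
      rw [h2] at h1
      change ¬ _ < d at hcon
      change σ.reg z = ((divMod x b z q e).sem σ).reg z + _ at h1
      omega
  change σ.reg z = ((divMod x b z q e).sem σ).reg z +
    d * ((divMod x b z q e).sem σ).reg q at h1
  rw [h1]
  constructor
  · rw [Nat.add_mul_mod_self_left, Nat.mod_eq_of_lt hlt]
  · rw [Nat.add_mul_div_left _ _ hd, Nat.div_eq_of_lt hlt, zero_add]

end FP

end RAM

/-! ### Bicliques in graphs with an ordering of small outdegree -/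

namespace BFVD

/-- An instance of the problem on the vertices `0, …, n - 1`, together with an ordering `ord` of
the vertices in which every vertex has at most `d` later neighbours. Vertices are natural numbers,
so that sets of vertices can be read off from the memory of the machine. Adjacent vertices have
distinct positions; more is not required of `ord`. -/
structure Inst where
  n : ℕ
  i : ℕ
  j : ℕ
  k : ℕ
  d : ℕ
  adj : ℕ → ℕ → Prop
  ord : ℕ → ℕ
  i_pos : 1 ≤ i
  j_pos : 1 ≤ j
  symm : ∀ {u v}, adj u v → adj v u
  lt : ∀ {u v}, adj u v → v < n
  ord_ne : ∀ {u v}, adj u v → ord u ≠ ord v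
  card_le : ∀ (u : ℕ) (S : Finset ℕ), (∀ v ∈ S, adj u v ∧ ord u < ord v) → S.card ≤ d

namespace Inst

variable (I : Inst)

open Finset Classical

/-- `v` is a later neighbour of `u`. -/
def Out (u v : ℕ) : Prop := I.adj u v ∧ I.ord u < I.ord v

/-- The later neighbours of `u`. -/
noncomputable def out (u : ℕ) : Finset ℕ := {v ∈ range I.n | I.Out u v}

/-- The common neighbours of the vertices in `S` that do not lie in `R`. -/
noncomputable def common (R S : Finset ℕ) : Finset ℕ :=
  {w ∈ range I.n | w ∉ R ∧ ∀ v ∈ S, I.adj v w}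

/-- `S` is one side of a copy of `K_{i,j}` that avoids `R`. -/
def Bad (R S : Finset ℕ) : Prop :=
  (∀ v ∈ S, v ∉ R) ∧
    ((#S = I.i ∧ I.j ≤ #(I.common R S)) ∨ (#S = I.j ∧ I.i ≤ #(I.common R S)))

/-- There is a copy of `K_{i,j}` that avoids `R`. -/
def Biclique (R : Finset ℕ) : Prop :=
  ∃ S T : Finset ℕ, S ⊆ range I.n ∧ T ⊆ range I.n ∧ #S = I.i ∧ #T = I.j ∧
    (∀ v ∈ S, v ∉ R) ∧ (∀ w ∈ T, w ∉ R) ∧ ∀ v ∈ S, ∀ w ∈ T, I.adj v w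

/-- All copies of `K_{i,j}` that avoid `R` can be destroyed by deleting `m` vertices. -/
def Yes (R : Finset ℕ) (m : ℕ) : Prop := ∃ D : Finset ℕ, #D ≤ m ∧ ¬ I.Biclique (R ∪ D)

variable {I} {R S X : Finset ℕ}

theorem mem_out {u v : ℕ} : v ∈ I.out u ↔ I.Out u v := by
  simp only [out, mem_filter, mem_range, and_iff_right_iff_imp]
  exact fun h => I.lt h.1

theorem card_out_le (u : ℕ) : #(I.out u) ≤ I.d :=
  I.card_le u _ fun _ h => mem_out.1 h

theorem mem_common {w : ℕ} :
    w ∈ I.common R S ↔ w < I.n ∧ w ∉ R ∧ ∀ v ∈ S, I.adj v w := by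
  simp [common]

theorem out_subset (u : ℕ) : I.out u ⊆ range I.n := filter_subset _ _

theorem Bad.biclique (h : I.Bad R S) (hS : S ⊆ range I.n) : I.Biclique R := by
  obtain ⟨hR, ⟨hi, hj⟩ | ⟨hj, hi⟩⟩ := h
  · obtain ⟨T, hT, hTc⟩ := exists_subset_card_eq hj
    exact ⟨S, T, hS, hT.trans (filter_subset _ _), hi, hTc, hR,
      fun w hw => (mem_common.1 (hT hw)).2.1, fun v hv w hw => (mem_common.1 (hT hw)).2.2 v hv⟩
  · obtain ⟨T, hT, hTc⟩ := exists_subset_card_eq hi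
    exact ⟨T, S, hT.trans (filter_subset _ _), hS, hTc, hj,
      fun w hw => (mem_common.1 (hT hw)).2.1, hR,
      fun w hw v hv => I.symm ((mem_common.1 (hT hw)).2.2 v hv)⟩

/-- The first vertex `u` of a biclique has the side opposite to it among its later neighbours. -/
theorem Biclique.exists_bad (h : I.Biclique R) :
    ∃ u < I.n, ∃ S ⊆ I.out u, I.Bad R S := by
  obtain ⟨S, T, hS, hT, hSc, hTc, hSR, hTR, hadj⟩ := h
  have hne : (S ∪ T).Nonempty := by
    rw [← card_pos]
    have := card_le_card (subset_union_left (s₁ := S) (s₂ := T))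
    have := I.i_pos
    omega
  obtain ⟨u, hu, hmin⟩ := exists_min_image (S ∪ T) I.ord hne
  have hun : u < I.n := mem_range.1 (union_subset hS hT hu)
  refine ⟨u, hun, ?_⟩
  have hout : ∀ w ∈ S ∪ T, I.adj u w → w ∈ I.out u := fun w hw ha =>
    mem_out.2 ⟨ha, lt_of_le_of_ne (hmin w hw) (I.ord_ne ha)⟩
  rcases mem_union.1 hu with h | h
  · refine ⟨T, fun w hw => hout w (mem_union_right _ hw) (hadj u h w hw), hTR,
      .inr ⟨hTc, hSc ▸ card_le_card fun v hv => mem_common.2 ⟨mem_range.1 (hS hv), hSR v hv,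
        fun w hw => I.symm (hadj v hv w hw)⟩⟩⟩
  · refine ⟨S, fun w hw => hout w (mem_union_left _ hw) (I.symm (hadj w hw u h)), hSR,
      .inl ⟨hSc, hTc ▸ card_le_card fun v hv => mem_common.2 ⟨mem_range.1 (hT hv), hTR v hv,
        fun _ hw => hadj _ hw v hv⟩⟩⟩

theorem common_anti {R' : Finset ℕ} (h : R ⊆ R') : I.common R' S ⊆ I.common R S :=
  fun _ hw => mem_common.2 ⟨(mem_common.1 hw).1, fun h' => (mem_common.1 hw).2.1 (h h'),
    (mem_common.1 hw).2.2⟩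

theorem Bad.anti {R' : Finset ℕ} (h : R ⊆ R') (hB : I.Bad R' S) : I.Bad R S := by
  have := card_le_card (common_anti (I := I) (S := S) h)
  exact ⟨fun v hv hR => hB.1 v hv (h hR), hB.2.imp (fun h => ⟨h.1, h.2.trans this⟩)
    (fun h => ⟨h.1, h.2.trans this⟩)⟩

theorem Biclique.anti {R' : Finset ℕ} (h : R ⊆ R') (hB : I.Biclique R') : I.Biclique R := by
  obtain ⟨u, _, S, hS, hb⟩ := hB.exists_bad
  exact (hb.anti h).biclique (hS.trans (out_subset u))

theorem Bad.nonempty (h : I.Bad R S) : S.Nonempty := by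
  rw [← card_pos]
  have := I.i_pos
  have := I.j_pos
  rcases h.2 with h | h <;> omega

/-! ### The core of the branching set -/

variable (I)

/-- The number of later neighbours of `u` below `v`. -/
noncomputable def rank (u v : ℕ) : ℕ := Nat.count (fun w => I.Out u w) v

/-- The set of later neighbours of `u` whose characteristic vector is the binary expansion
of `s`. -/
noncomputable def decode (u s : ℕ) : Finset ℕ :=
  {v ∈ range I.n | I.Out u v ∧ s / 2 ^ I.rank u v % 2 = 1}

/-- Add `S` to `X` if `S` is a side of a biclique and `X` is still small. -/
noncomputable def coreStep (R X S : Finset ℕ) : Finset ℕ :=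
  if I.Bad R S ∧ #X ≤ I.k * I.d then X ∪ S else X

/-- `coreStep` for the first `m` sets of later neighbours of `u`. -/
noncomputable def coreRow (R : Finset ℕ) (u : ℕ) (X : Finset ℕ) : ℕ → Finset ℕ
  | 0 => X
  | m + 1 => I.coreStep R (coreRow R u X m) (I.decode u m)

/-- `coreRow` for the first `m` vertices, starting from the empty set. -/
noncomputable def coreUpTo (R : Finset ℕ) : ℕ → Finset ℕ
  | 0 => ∅
  | m + 1 => I.coreRow R m (coreUpTo R m) (2 ^ I.d)

/-- The core for the deleted set `R`: a greedy union of sides of bicliques that avoid `R`, stopped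
as soon as it has more than `k * d` elements. -/
noncomputable def core (R : Finset ℕ) : Finset ℕ := I.coreUpTo R I.n

variable {I}

theorem decode_subset (u s : ℕ) : I.decode u s ⊆ I.out u := fun _ hv =>
  mem_out.2 (mem_filter.1 hv).2.1

/-- Every set of later neighbours of `u` is met when `s` runs through the numbers below
`2 ^ d`. -/
theorem exists_decode_eq {u : ℕ} (hS : S ⊆ I.out u) : ∃ s < 2 ^ I.d, I.decode u s = S := by
  refine ⟨Nat.ofBits (n := I.d) fun r => decide (∃ v ∈ S, I.rank u v = r),
    Nat.ofBits_lt_two_pow _, ?_⟩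
  have hrank : ∀ v, I.Out u v → I.rank u v < I.d := fun v hv =>
    by
    have h1 := Nat.count_strict_mono (p := fun w => I.Out u w) hv (I.lt hv.1)
    have h2 := card_out_le (I := I) u
    exact h1.trans_le (by rw [Nat.count_eq_card_filter_range]; exact h2)
  ext v
  simp only [decode, mem_filter, mem_range]
  constructor
  · rintro ⟨-, ho, hb⟩
    rw [← Nat.shiftRight_eq_div_pow] at hb
    have : Nat.testBit (Nat.ofBits (n := I.d) fun r => decide (∃ v ∈ S, I.rank u v = r))
        (I.rank u v) = true := by
      rw [Nat.testBit, Nat.and_comm, Nat.and_one_is_mod, hb]; rfl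
    rw [Nat.testBit_ofBits_lt _ _ (hrank v ho)] at this
    obtain ⟨w, hw, hr⟩ := of_decide_eq_true this
    rwa [Nat.count_injective (mem_out.1 (hS hw)) ho hr] at hw
  · intro hv
    have ho := mem_out.1 (hS hv)
    refine ⟨I.lt ho.1, ho, ?_⟩
    have : Nat.testBit (Nat.ofBits (n := I.d) fun r => decide (∃ v ∈ S, I.rank u v = r))
        (I.rank u v) = true := by
      rw [Nat.testBit_ofBits_lt _ _ (hrank v ho)]
      exact decide_eq_true ⟨v, hv, rfl⟩
    rw [Nat.testBit, Nat.and_comm, Nat.and_one_is_mod, Nat.shiftRight_eq_div_pow] at this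
    rcases Nat.mod_two_eq_zero_or_one (Nat.ofBits (n := I.d)
      (fun r => decide (∃ v ∈ S, I.rank u v = r)) / 2 ^ I.rank u v) with h | h
    · rw [h] at this; simp at this
    · exact h

/-- Induction along the greedy computation of the core. -/
theorem core_induction {P : Finset ℕ → Prop} (h0 : P ∅)
    (hs : ∀ X u s, P X → P (I.coreStep R X (I.decode u s))) : P (I.core R) := by
  have hrow : ∀ u X m, P X → P (I.coreRow R u X m) := by
    intro u X m hX
    induction m with
    | zero => exact hX
    | succ m ih => exact hs _ _ _ ih
  have : ∀ m, P (I.coreUpTo R m) := by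
    intro m
    induction m with
    | zero => exact h0
    | succ m ih => exact hrow _ _ _ ih
  exact this _

theorem core_subset : I.core R ⊆ range I.n := by
  refine core_induction (P := fun X => X ⊆ range I.n) (empty_subset _) fun X u s hX => ?_
  unfold coreStep
  split_ifs
  · exact union_subset hX ((decode_subset u s).trans (out_subset u))
  · exact hX

theorem card_core_le : #(I.core R) ≤ I.k * I.d + I.d := by
  refine core_induction (P := fun X => #X ≤ I.k * I.d + I.d) (by simp) fun X u s hX => ?_
  unfold coreStep
  split_ifs with h
  · refine (card_union_le _ _).trans (add_le_add h.2 ?_)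
    exact (card_le_card (decode_subset u s)).trans (card_out_le u)
  · exact hX

/-- The core is a union of sides of bicliques. -/
theorem exists_bad_of_mem_core {x : ℕ} (hx : x ∈ I.core R) :
    ∃ u, ∃ S ⊆ I.out u, x ∈ S ∧ S ⊆ I.core R ∧ I.Bad R S := by
  refine core_induction (I := I) (R := R) (P := fun X => ∀ x ∈ X, ∃ u, ∃ S ⊆ I.out u, x ∈ S ∧
    S ⊆ X ∧ I.Bad R S) (by simp) (fun X u s hX => ?_) x hx
  unfold coreStep
  split_ifs with h
  · intro x hx
    rcases mem_union.1 hx with hx | hx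
    · obtain ⟨u, S, h1, h2, h3, h4⟩ := hX x hx
      exact ⟨u, S, h1, h2, h3.trans subset_union_left, h4⟩
    · exact ⟨u, _, decode_subset u s, hx, subset_union_right, h.1⟩
  · exact hX

theorem subset_coreStep : X ⊆ I.coreStep R X S := by
  unfold coreStep
  split_ifs
  exacts [subset_union_left, Subset.rfl]

theorem coreRow_mono (u : ℕ) (X : Finset ℕ) : Monotone (I.coreRow R u X) :=
  monotone_nat_of_le_succ fun _ => subset_coreStep

theorem coreUpTo_mono : Monotone (I.coreUpTo R) :=
  monotone_nat_of_le_succ fun m => coreRow_mono m _ (Nat.zero_le _)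

/-- A core that has at most `k * d` elements contains all sides of bicliques that consist of later
neighbours of one vertex. -/
theorem Bad.subset_core (h : I.Bad R S) {u : ℕ} (hu : u < I.n) (hS : S ⊆ I.out u)
    (hc : #(I.core R) ≤ I.k * I.d) : S ⊆ I.core R := by
  obtain ⟨s, hs, rfl⟩ := exists_decode_eq hS
  have h1 : I.coreRow R u (I.coreUpTo R u) (s + 1) ⊆ I.core R :=
    (coreRow_mono u _ (by omega)).trans (coreUpTo_mono (by omega : u + 1 ≤ I.n))
  have h2 : #(I.coreRow R u (I.coreUpTo R u) s) ≤ I.k * I.d :=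
    (card_le_card ((coreRow_mono u _ (Nat.le_succ s)).trans h1)).trans hc
  refine Subset.trans ?_ h1
  rw [coreRow, coreStep, if_pos ⟨h, h2⟩]
  exact subset_union_right

/-- The emptiness of the core decides whether a biclique is left. -/
theorem core_eq_empty_iff : I.core R = ∅ ↔ ¬ I.Biclique R := by
  constructor
  · intro h hB
    obtain ⟨u, hu, S, hS, hb⟩ := hB.exists_bad
    have := hb.subset_core hu hS (by simp [h])
    rw [h, subset_empty] at this
    exact hb.nonempty.ne_empty this
  · intro h
    by_contra hne
    obtain ⟨x, hx⟩ := nonempty_iff_ne_empty.2 hne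
    obtain ⟨u, S, hS, -, -, hb⟩ := exists_bad_of_mem_core hx
    exact h (hb.biclique (hS.trans (out_subset u)))

/-! ### The branching step -/

variable (I)

/-- No vertex below `v` outside of `R` and `X` has the same neighbours in `X` as `v`. -/
def IsRep (R X : Finset ℕ) (v : ℕ) : Prop :=
  ∀ w < v, w ∉ R → w ∉ X → ∃ x ∈ X, ¬ (I.adj x v ↔ I.adj x w)

/-- The vertices to branch on: the core, the later neighbours of its elements, and one vertex for
each possible neighbourhood in the core. -/
noncomputable def branch (R X : Finset ℕ) : Finset ℕ :=
  {v ∈ range I.n | v ∉ R ∧ (v ∈ X ∨ (∃ x ∈ X, I.Out x v) ∨ I.IsRep R X v)}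

variable {I}

/-- Distinct vertices outside of `X` that are both first with their neighbourhood in `X` have
different neighbourhoods in `X`, so there are at most `2 ^ #X` such vertices. -/
theorem card_branch_le : #(I.branch R X) ≤ #X + #X * I.d + 2 ^ #X := by
  have hsub : I.branch R X ⊆ (X ∪ X.biUnion I.out) ∪
      {v ∈ I.branch R X | v ∉ X ∧ I.IsRep R X v} := by
    intro v hv
    by_cases hX : v ∈ X
    · simp [hX]
    · have h := (mem_filter.1 hv).2
      rcases h.2 with h | ⟨x, hx, ho⟩ | h
      · exact absurd h hX
      · exact mem_union_left _ (mem_union_right _ (mem_biUnion.2 ⟨x, hx, mem_out.2 ho⟩))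
      · exact mem_union_right _ (mem_filter.2 ⟨hv, hX, h⟩)
  have h1 : #(X.biUnion I.out) ≤ #X * I.d := card_biUnion_le_card_mul _ _ _ fun u _ => card_out_le u
  have h2 : #{v ∈ I.branch R X | v ∉ X ∧ I.IsRep R X v} ≤ 2 ^ #X := by
    rw [← card_powerset]
    refine card_le_card_of_injOn (fun v => {x ∈ X | I.adj x v})
      (fun v _ => by
        simp only [mem_coe, mem_powerset]
        exact filter_subset _ _) ?_
    intro v hv w hw hvw
    simp only [coe_filter, Set.mem_ofPred_eq, branch, mem_filter] at hv hw
    have hiff : ∀ x ∈ X, (I.adj x v ↔ I.adj x w) := fun x hx => by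
      have := congrArg (x ∈ ·) hvw
      simpa [hx] using this
    rcases lt_trichotomy v w with h | h | h
    · obtain ⟨x, hx, hn⟩ := hw.2.2 v h hv.1.2.1 hv.2.1
      exact absurd (hiff x hx).symm hn
    · exact h
    · obtain ⟨x, hx, hn⟩ := hv.2.2 w h hw.1.2.1 hw.2.1
      exact absurd (hiff x hx) hn
  calc #(I.branch R X) ≤ _ := card_le_card hsub
    _ ≤ _ := (card_union_le _ _).trans (add_le_add ((card_union_le _ _).trans
      (add_le_add_right h1 _)) h2)

theorem card_branch_core_le (hk : 1 ≤ I.k) :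
    #(I.branch R (I.core R)) ≤ 2 ^ (I.k * (6 * I.d)) := by
  rcases Nat.eq_zero_or_pos I.d with hd | hd
  · have h1 := card_branch_le (I := I) (R := R) (X := I.core R)
    have h2 := card_core_le (I := I) (R := R)
    have h3 : #(I.core R) = 0 := by simpa [hd] using h2
    simpa [h3, hd] using h1
  · set m := 2 * (I.k * I.d) with hm
    have hdk : I.d ≤ I.k * I.d := Nat.le_mul_of_pos_left _ hk
    have h2 : #(I.core R) ≤ m := card_core_le.trans (by omega)
    have hm2 : m + 1 ≤ 2 ^ m := Nat.lt_two_pow_self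
    have hd2 : I.d + 1 ≤ 2 ^ m := by omega
    have h4 : 2 ≤ 2 ^ m := by omega
    calc #(I.branch R (I.core R))
        ≤ #(I.core R) + #(I.core R) * I.d + 2 ^ #(I.core R) :=
          card_branch_le
      _ ≤ m + m * I.d + 2 ^ m := by gcongr; norm_num
      _ ≤ 2 ^ m * 2 ^ m + 2 ^ m * 2 ^ m := by nlinarith
      _ = 2 * (2 ^ m * 2 ^ m) := by ring
      _ ≤ 2 ^ m * (2 ^ m * 2 ^ m) := Nat.mul_le_mul_right _ h4
      _ = 2 ^ (I.k * (6 * I.d)) := by rw [← pow_add, ← pow_add, hm]; congr 1; ring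

theorem union_erase_insert {E : Finset ℕ} {v : ℕ} (hv : v ∈ E) :
    insert v R ∪ E.erase v = R ∪ E := by
  rw [insert_union, ← union_insert, insert_erase hv]

/-- If the instance is solvable, then some solution contains a vertex of the branching set. A
solution that avoids the core destroys each biclique side in the core through a common neighbour;
if it also avoids the later neighbours of the core, then the core consists of later neighbours of
the solution, so that it is small. A small core contains all biclique sides, and then solution
vertices may be exchanged for vertices with the same neighbours in the core. -/
theorem Yes.exists_branch {m : ℕ} (hm : m + 1 ≤ I.k) (hY : I.Yes R (m + 1))
    (hB : I.Biclique R) : ∃ v ∈ I.branch R (I.core R), I.Yes (insert v R) m := by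
  obtain ⟨D, hD, hfree⟩ := hY
  set E := D \ R with hE
  have hEc : #E ≤ m + 1 := (card_le_card sdiff_subset).trans hD
  have hRE : R ∪ E = R ∪ D := union_sdiff_self_eq_union
  rw [← hRE] at hfree
  have hER : ∀ v ∈ E, v ∉ R := fun v hv => (mem_sdiff.1 hv).2
  have hmem : ∀ v ∈ E, I.Yes (insert v R) m := fun v hv =>
    ⟨E.erase v, by rw [card_erase_of_mem hv]; omega, by rwa [union_erase_insert hv]⟩
  by_cases h1 : ∃ v ∈ E, v ∈ I.core R ∨ ∃ x ∈ I.core R, I.Out x v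
  · obtain ⟨v, hv, h⟩ := h1
    refine ⟨v, mem_filter.2 ⟨?_, hER v hv, h.imp_right .inl⟩, hmem v hv⟩
    rcases h with h | ⟨x, -, h⟩
    · exact core_subset h
    · exact mem_range.2 (I.lt h.1)
  push Not at h1
  -- The solution destroys every biclique side in the core through a common neighbour.
  have hhit : ∀ u, ∀ S ⊆ I.out u, S ⊆ I.core R → I.Bad R S → ∃ w ∈ E, w ∈ I.common R S := by
    intro u S hS hSX hb
    by_contra! hno
    have hcom : I.common R S ⊆ I.common (R ∪ E) S := fun w hw => by
      have hw' := mem_common.1 hw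
      refine mem_common.2 ⟨hw'.1, ?_, hw'.2.2⟩
      rw [mem_union, not_or]
      exact ⟨hw'.2.1, fun hwE => hno w hwE hw⟩
    have hc := card_le_card hcom
    refine hfree (Bad.biclique (S := S) ⟨?_, ?_⟩ (hS.trans (out_subset u)))
    · intro v hv
      rw [mem_union, not_or]
      exact ⟨hb.1 v hv, fun hvE => (h1 v hvE).1 (hSX hv)⟩
    · exact hb.2.imp (fun h => ⟨h.1, h.2.trans hc⟩) (fun h => ⟨h.1, h.2.trans hc⟩)
  have hsmall : #(I.core R) ≤ I.k * I.d := by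
    have hsub : I.core R ⊆ E.biUnion I.out := by
      intro x hx
      obtain ⟨u, S, hS, hxS, hSX, hb⟩ := exists_bad_of_mem_core hx
      obtain ⟨w, hwE, hw⟩ := hhit u S hS hSX hb
      have hxw := (mem_common.1 hw).2.2 x hxS
      refine mem_biUnion.2 ⟨w, hwE, mem_out.2 ⟨I.symm hxw, ?_⟩⟩
      have := (h1 w hwE).2 x hx
      have hne := I.ord_ne hxw
      simp only [Out, hxw, true_and] at this
      omega
    calc #(I.core R) ≤ #E * I.d := (card_le_card hsub).trans
          (card_biUnion_le_card_mul _ _ _ fun u _ => card_out_le u)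
      _ ≤ I.k * I.d := Nat.mul_le_mul_right _ (hEc.trans hm)
  obtain ⟨u, hu, S, hS, hb⟩ := hB.exists_bad
  obtain ⟨w, hwE, hw⟩ := hhit u S hS (hb.subset_core hu hS hsmall) hb
  have hwX : w ∉ I.core R := (h1 w hwE).1
  -- `v` is the first vertex with the same neighbours in the core as `w`.
  have hex : ∃ v, v ∉ R ∧ v ∉ I.core R ∧ ∀ x ∈ I.core R, (I.adj x v ↔ I.adj x w) :=
    ⟨w, hER w hwE, hwX, fun _ _ => Iff.rfl⟩
  set v := Nat.find hex with hv
  obtain ⟨hvR, hvX, hvw⟩ := Nat.find_spec hex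
  have hvle : v ≤ w := Nat.find_min' hex ⟨hER w hwE, hwX, fun _ _ => Iff.rfl⟩
  have hvn : v < I.n := hvle.trans_lt (mem_common.1 hw).1
  refine ⟨v, mem_filter.2 ⟨mem_range.2 hvn, hvR, .inr (.inr ?_)⟩, ?_⟩
  · intro y hy hyR hyX
    have := Nat.find_min hex hy
    by_contra! hcon
    exact this ⟨hyR, hyX, fun x hx => (hcon x hx).symm.trans (hvw x hx)⟩
  by_cases hvE : v ∈ E
  · exact hmem v hvE
  refine ⟨E.erase w, by rw [card_erase_of_mem hwE]; omega, fun hB' => hfree ?_⟩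
  obtain ⟨u', hu', S', hS', hb'⟩ := hB'.exists_bad
  have hbR : I.Bad R S' := hb'.anti ((subset_insert v R).trans subset_union_left)
  have hSX := hbR.subset_core hu' hS' hsmall
  have hc : #(I.common (insert v R ∪ E.erase w) S') ≤ #(I.common (R ∪ E) S') := by
    refine card_le_card_of_injOn (fun y => if y = w then v else y) ?_ ?_
    · intro y hy
      have hy' := mem_common.1 hy
      simp only [mem_union, mem_insert, mem_erase, not_or, not_and] at hy'
      simp only
      split_ifs with hyw
      · subst hyw
        refine mem_common.2 ⟨hvn, by
          rw [mem_union, not_or]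
          exact ⟨hvR, hvE⟩, fun x hx => ?_⟩
        exact (hvw x (hSX hx)).2 (hy'.2.2 x hx)
      · refine mem_common.2 ⟨hy'.1, ?_, hy'.2.2⟩
        rw [mem_union, not_or]
        exact ⟨hy'.2.1.1.2, hy'.2.1.2 hyw⟩
    · intro y hy z hz hyz
      have hne : ∀ t ∈ I.common (insert v R ∪ E.erase w) S', t ≠ v := by
        rintro t ht rfl
        exact (mem_common.1 ht).2.1 (mem_union_left _ (mem_insert_self _ _))
      simp only at hyz
      split_ifs at hyz with h h' h'
      · rw [h, h']
      · exact absurd hyz.symm (hne z hz)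
      · exact absurd hyz (hne y hy)
      · exact hyz
  refine Bad.biclique (S := S') ⟨?_, ?_⟩ (hS'.trans (out_subset u'))
  · intro x hx
    rw [mem_union, not_or]
    exact ⟨hbR.1 x hx, fun hxE => (h1 x hxE).1 (hSX hx)⟩
  · exact hb'.2.imp (fun h => ⟨h.1, h.2.trans hc⟩) (fun h => ⟨h.1, h.2.trans hc⟩)

/-! ### Runs of the algorithm -/

variable (I)

/-- The number of choices in a branching step, an upper bound for the size of the branching
set. -/
def base : ℕ := 2 ^ (I.k * (6 * I.d))

/-- The element below `v` of `L` that has exactly `g` predecessors in `L`; it is `n` if there is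
none. -/
noncomputable def pickUpTo (L : Finset ℕ) (g : ℕ) : ℕ → ℕ
  | 0 => I.n
  | v + 1 => if v ∈ L ∧ Nat.count (· ∈ L) v = g then v else pickUpTo L g v

/-- The deleted set after one step in which the choice is `g`. If the branching set has at most `g`
elements, then the number `n`, which is not a vertex, is added. -/
noncomputable def next (R : Finset ℕ) (g : ℕ) : Finset ℕ :=
  insert (I.pickUpTo (I.branch R (I.core R)) g I.n) R

/-- The deleted set after `m` further steps, in which the choices are the digits of `y` in
base `base`, starting with the least significant one. -/
noncomputable def run : ℕ → ℕ → Finset ℕ → Finset ℕ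
  | 0, _, R => R
  | m + 1, y, R => run m (y / I.base) (I.next R (y % I.base))

variable {I}

theorem card_run_le (m y : ℕ) (R : Finset ℕ) : #(I.run m y R) ≤ #R + m := by
  induction m generalizing y R with
  | zero => simp [run]
  | succ m ih =>
    have := card_insert_le (I.pickUpTo (I.branch R (I.core R)) (y % I.base) I.n) R
    have h2 := ih (y / I.base) (I.next R (y % I.base))
    rw [run]
    unfold next at *
    omega

theorem pickUpTo_eq {L : Finset ℕ} {v : ℕ} (hv : v ∈ L) :
    ∀ m, v < m → I.pickUpTo L (Nat.count (· ∈ L) v) m = v := by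
  intro m
  induction m with
  | zero => intro h; omega
  | succ m ih =>
    intro h
    rw [pickUpTo]
    split_ifs with hc
    · exact Nat.count_injective hc.1 hv hc.2
    · refine ih (lt_of_le_of_ne (by omega) ?_)
      rintro rfl
      exact hc ⟨hv, rfl⟩

theorem base_pos : 0 < I.base := by unfold base; positivity

theorem exists_next_eq {v : ℕ} (hk : 1 ≤ I.k) (hv : v ∈ I.branch R (I.core R)) :
    ∃ g < I.base, I.next R g = insert v R := by
  have hvn : v < I.n := mem_range.1 (mem_filter.1 hv).1
  refine ⟨Nat.count (· ∈ I.branch R (I.core R)) v, ?_, by rw [next, pickUpTo_eq hv _ hvn]⟩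
  refine lt_of_lt_of_le ?_ (card_branch_core_le (R := R) hk)
  calc Nat.count (· ∈ I.branch R (I.core R)) v < Nat.count (· ∈ I.branch R (I.core R)) I.n :=
        Nat.count_strict_mono hv hvn
    _ = #(I.branch R (I.core R)) := by
        rw [Nat.count_eq_card_filter_range]
        congr 1
        ext w
        simp only [mem_filter, mem_range, and_iff_right_iff_imp]
        exact fun h => mem_range.1 (mem_filter.1 h).1

/-- The digits of `y` are the choices that keep the instance solvable. Once no biclique is left, any
choice does. -/
theorem Yes.exists_run (m : ℕ) (hm : m ≤ I.k) (hY : I.Yes R m) :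
    ∃ y < I.base ^ m, ¬ I.Biclique (I.run m y R) := by
  induction m generalizing R with
  | zero =>
    obtain ⟨D, hD, h⟩ := hY
    obtain rfl : D = ∅ := by simpa using hD
    exact ⟨0, by simp, by simpa [run] using h⟩
  | succ m ih =>
    have key : ∃ g < I.base, I.Yes (I.next R g) m := by
      by_cases hB : I.Biclique R
      · obtain ⟨v, hv, hYv⟩ := hY.exists_branch hm hB
        obtain ⟨g, hg, e⟩ := exists_next_eq (by omega) hv
        exact ⟨g, hg, e ▸ hYv⟩
      · exact ⟨0, base_pos, ∅, by simp, fun h =>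
          hB (h.anti ((subset_insert _ _).trans subset_union_left))⟩
    obtain ⟨g, hg, hYg⟩ := key
    obtain ⟨y, hy, h⟩ := ih (by omega) hYg
    refine ⟨g + I.base * y, ?_, ?_⟩
    · calc g + I.base * y < I.base * (y + 1) := by rw [mul_add]; omega
        _ ≤ I.base * I.base ^ m := Nat.mul_le_mul_left _ hy
        _ = I.base ^ (m + 1) := by rw [pow_succ']
    · rwa [run, Nat.add_mul_mod_self_left, Nat.mod_eq_of_lt hg,
        Nat.add_mul_div_left _ _ base_pos, Nat.div_eq_of_lt hg, zero_add]

/-- Some run ends without bicliques if and only if the instance is solvable: a run deletes at most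
`k` vertices, and conversely `Yes.exists_run` steers a run through a solution. -/
theorem exists_run_iff :
    (∃ y < I.base ^ I.k, I.core (I.run I.k y ∅) = ∅) ↔ I.Yes ∅ I.k := by
  simp only [core_eq_empty_iff]
  constructor
  · rintro ⟨y, -, h⟩
    exact ⟨I.run I.k y ∅, by simpa using card_run_le (I := I) I.k y ∅, by simpa using h⟩
  · exact fun h => h.exists_run _ le_rfl

end Inst

end BFVD

/-! ### Graphs on the vertices `0, …, n - 1` -/

namespace BFVD

open Finset

/-- The adjacency relation of `G` on natural numbers. -/
def natAdj {n : ℕ} (G : SimpleGraph (Fin n)) (u v : ℕ) : Prop :=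
  ∃ (hu : u < n) (hv : v < n), G.Adj ⟨u, hu⟩ ⟨v, hv⟩

theorem isContained_iff_biclique {n : ℕ} {G : SimpleGraph (Fin n)} {I : Inst} (hn : I.n = n)
    (hadj : I.adj = natAdj G) (D : Finset (Fin n)) :
    (completeBipartiteGraph (Fin I.i) (Fin I.j)).IsContained (G.induce ((D : Set (Fin n))ᶜ)) ↔
      I.Biclique (D.map Fin.valEmbedding) := by
  classical
  rw [SimpleGraph.completeBipartiteGraph_isContained_iff]
  have hlt : ∀ f : Finset ↥((D : Set (Fin n))ᶜ),
      f.map ((Function.Embedding.subtype _).trans Fin.valEmbedding) ⊆ range I.n := by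
    intro f x hx
    obtain ⟨y, -, rfl⟩ := mem_map.1 hx
    exact mem_range.2 (hn ▸ y.1.2)
  have hD : ∀ f : Finset ↥((D : Set (Fin n))ᶜ),
      ∀ v ∈ f.map ((Function.Embedding.subtype _).trans Fin.valEmbedding),
      v ∉ D.map Fin.valEmbedding := by
    intro f x hx hxD
    obtain ⟨y, -, rfl⟩ := mem_map.1 hx
    obtain ⟨z, hz, e⟩ := mem_map.1 hxD
    obtain rfl : z = y.1 := Fin.val_injective e
    exact y.2 hz
  constructor
  · rintro ⟨S, T, hS, hT, h⟩
    refine ⟨_, _, hlt S, hlt T, by simpa using hS, by simpa using hT, hD S, hD T, ?_⟩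
    intro v hv w hw
    obtain ⟨a, ha, rfl⟩ := mem_map.1 hv
    obtain ⟨b, hb, rfl⟩ := mem_map.1 hw
    rw [hadj]
    exact ⟨a.1.2, b.1.2, h ha hb⟩
  · rintro ⟨S, T, hS, hT, hSc, hTc, hSD, hTD, h⟩
    have key : ∀ S : Finset ℕ, S ⊆ range I.n → (∀ v ∈ S, v ∉ D.map Fin.valEmbedding) →
        #{x : ↥((D : Set (Fin n))ᶜ) | x.1.1 ∈ S} = #S := by
      intro S hS hSD
      refine card_nbij (fun x => x.1.1) (fun x hx => by simpa using hx)
        (fun x _ y _ hxy => Subtype.ext (Fin.ext hxy)) ?_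
      intro v hv
      have hvn : v < n := hn ▸ mem_range.1 (hS hv)
      refine ⟨⟨⟨v, hvn⟩, fun hmem => hSD v hv (mem_map.2 ⟨_, hmem, rfl⟩)⟩, ?_, rfl⟩
      simpa using hv
    refine ⟨_, _, by simpa using (key S hS hSD).trans hSc,
      by simpa using (key T hT hTD).trans hTc, ?_⟩
    intro a ha b hb
    have := h a.1.1 (by simpa using ha) b.1.1 (by simpa using hb)
    rw [hadj] at this
    exact this.2.2

/-- The instance on natural numbers has the same answer as the instance on `Fin n`. -/
theorem isYesInstance_iff {n : ℕ} {G : SimpleGraph (Fin n)} {I : Inst} (hn : I.n = n)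
    (hadj : I.adj = natAdj G) {k : ℕ} :
    IsYesInstance G I.i I.j k ↔ I.Yes ∅ (min k n) := by
  classical
  constructor
  · rintro ⟨D, hD, hf⟩
    refine ⟨D.map Fin.valEmbedding, ?_, ?_⟩
    · have := card_le_univ D
      rw [Fintype.card_fin] at this
      rw [card_map]
      exact le_min hD this
    · rw [empty_union, ← isContained_iff_biclique hn hadj]
      exact hf
  · rintro ⟨D, hD, hf⟩
    refine ⟨({x : Fin n | x.1 ∈ D} : Finset (Fin n)), ?_, ?_⟩
    · refine le_trans ?_ (hD.trans (min_le_left _ _))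
      exact card_le_card_of_injOn Fin.val (fun x hx => by simpa using hx)
        Fin.val_injective.injOn
    · intro hc
      rw [isContained_iff_biclique hn hadj] at hc
      rw [empty_union] at hf
      obtain ⟨S, T, hS, hT, hSc, hTc, hSD, hTD, h⟩ := hc
      have key : ∀ S : Finset ℕ, S ⊆ range I.n →
          (∀ v ∈ S, v ∉ ({x : Fin n | x.1 ∈ D} : Finset (Fin n)).map Fin.valEmbedding) →
          ∀ v ∈ S, v ∉ D := by
        intro S hS hSD v hv hvD
        have hvn : v < n := hn ▸ mem_range.1 (hS hv)
        exact hSD v hv (mem_map.2 ⟨⟨v, hvn⟩, by simpa using hvD, rfl⟩)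
      exact hf ⟨S, T, hS, hT, hSc, hTc, key S hS hSD, key T hT hTD, h⟩

theorem input_mem {n : ℕ} (G : SimpleGraph (Fin n)) (i j k : ℕ) {u v : ℕ} (hu : u < n)
    (hv : v < n) : (input G i j k).mem 0 (u * n + v) ≠ 0 ↔ natAdj G u v := by
  have key : ∀ a b : Fin n, u * n + v = a * n + b → u = a ∧ v = b := by
    intro a b h
    have h1 := congrArg (· / n) h
    have h2 := congrArg (· % n) h
    have hn : 0 < n := by omega
    simp only [mul_comm _ n, Nat.mul_add_div hn, Nat.div_eq_of_lt hv, Nat.div_eq_of_lt b.2,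
      Nat.mul_add_mod, Nat.mod_eq_of_lt hv, Nat.mod_eq_of_lt b.2] at h1 h2
    exact ⟨by simpa using h1, h2⟩
  simp only [input, true_and, ne_eq, ite_eq_right_iff, one_ne_zero, imp_false, not_not]
  constructor
  · rintro ⟨a, b, hab, h⟩
    obtain ⟨rfl, rfl⟩ := key a b h
    exact ⟨a.2, b.2, hab⟩
  · rintro ⟨hu, hv, h⟩
    exact ⟨_, _, h, rfl⟩

/-- The degeneracy of a graph bounds, in each nonempty set of vertices, some degree. -/
theorem exists_count_le_degeneracy {n : ℕ} (G : SimpleGraph (Fin n)) (P : ℕ → Prop)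
    (hP : ∃ v < n, P v) : ∃ v < n, P v ∧ ∀ S : Finset ℕ, (∀ w ∈ S, natAdj G v w ∧ P w) →
      #S ≤ degeneracy G := by
  classical
  have hne : {d : ℕ | IsDegenerate G d}.Nonempty := by
    refine ⟨n, fun S hS => ?_⟩
    obtain ⟨v, hv⟩ := hS
    refine ⟨v, hv, ?_⟩
    have := Set.ncard_le_card (G.neighborSet v ∩ (S : Set (Fin n)))
    simpa using this
  have hd : IsDegenerate G (degeneracy G) := Nat.sInf_mem hne
  obtain ⟨v, hv, hPv⟩ := hP
  obtain ⟨x, hx, hc⟩ := hd {x : Fin n | P x.1} ⟨⟨v, hv⟩, by simpa using hPv⟩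
  refine ⟨x.1, x.2, by simpa using hx, fun S hS => le_trans ?_ hc⟩
  have himg : (S : Set ℕ) ⊆ Fin.val '' (G.neighborSet x ∩
      (({x : Fin n | P x.1} : Finset (Fin n)) : Set (Fin n))) := by
    intro w hw
    obtain ⟨⟨_, hwn, ha⟩, hPw⟩ := hS w hw
    exact ⟨⟨w, hwn⟩, ⟨ha, by simpa using hPw⟩, rfl⟩
  rw [← Set.ncard_coe_finset]
  exact (Set.ncard_le_ncard himg (Set.toFinite _)).trans (Set.ncard_image_le (Set.toFinite _))

theorem degeneracy_le {n : ℕ} (G : SimpleGraph (Fin n)) : degeneracy G ≤ n := by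
  classical
  refine Nat.sInf_le fun S hS => ?_
  obtain ⟨v, hv⟩ := hS
  refine ⟨v, hv, ?_⟩
  have := Set.ncard_le_card (G.neighborSet v ∩ (S : Set (Fin n)))
  simpa using this

end BFVD

/-! ### The search program -/

namespace RAM.FP

open BFVD RAM.Expr

/-- Tests whether the vertices in registers `x` and `y` are adjacent. Array `1` holds the offsets of
the rows of the adjacency matrix. -/
def adjE (x y : ℕ) : Expr := .get 0 (.add (.get 1 (.reg x)) (.reg y))

/-- Tests whether the vertex in register `y` is a later neighbour of that in register `x`. -/
def outE (x y : ℕ) : Expr := Expr.and (adjE x y) (.lt (.get 2 (.reg x)) (.get 2 (.reg y)))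

/-- Add one to register `x`. -/
def incr (x : ℕ) : FP := assign x (.add (.reg x) (.const 1))

/-- The registers below `9` and the arrays below `3` describe the instance. They are fixed during
the search, which keeps the deleted set in array `3`, the core in array `4` and the current set of
later neighbours in array `5`. -/
structure Env (I : Inst) (σ : State) : Prop where
  n : σ.reg 0 = I.n
  i : σ.reg 1 = I.i
  j : σ.reg 2 = I.j
  k : σ.reg 3 = I.k
  d : σ.reg 4 = I.d
  kd : σ.reg 5 = I.k * I.d
  two_pow : σ.reg 6 = 2 ^ I.d
  base : σ.reg 7 = I.base
  base_pow : σ.reg 8 = I.base ^ I.k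
  adj : ∀ u < I.n, ∀ v < I.n, σ.mem 0 (σ.mem 1 u + v) ≠ 0 ↔ I.adj u v
  ord : ∀ u < I.n, σ.mem 2 u = I.ord u

/-- Array `a` holds the characteristic vector of `S`. -/
def Rep (I : Inst) (σ : State) (a : ℕ) (S : Finset ℕ) : Prop :=
  ∀ v < I.n, σ.mem a v ≠ 0 ↔ v ∈ S

variable {I : Inst} {σ ρ : State} {R X S : Finset ℕ}

theorem Env.frame {p : FP} (h : Env I σ) (hF : Frame p σ ρ) (hr : ∀ r < 9, p.wr r = false)
    (hm : ∀ a < 3, p.wm a = false) : Env I ρ := by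
  have e0 := hF.mem 0 (hm 0 (by norm_num))
  have e1 := hF.mem 1 (hm 1 (by norm_num))
  have e2 := hF.mem 2 (hm 2 (by norm_num))
  constructor
  · rw [hF.reg _ (hr _ (by norm_num)), h.n]
  · rw [hF.reg _ (hr _ (by norm_num)), h.i]
  · rw [hF.reg _ (hr _ (by norm_num)), h.j]
  · rw [hF.reg _ (hr _ (by norm_num)), h.k]
  · rw [hF.reg _ (hr _ (by norm_num)), h.d]
  · rw [hF.reg _ (hr _ (by norm_num)), h.kd]
  · rw [hF.reg _ (hr _ (by norm_num)), h.two_pow]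
  · rw [hF.reg _ (hr _ (by norm_num)), h.base]
  · rw [hF.reg _ (hr _ (by norm_num)), h.base_pow]
  · rw [e0, e1]; exact h.adj
  · rw [e2]; exact h.ord

theorem Env.sem {p : FP} (h : Env I σ) (hr : ∀ r < 9, p.wr r = false)
    (hm : ∀ a < 3, p.wm a = false) : Env I (p.sem σ) :=
  h.frame (frame_sem p σ) hr hm

theorem Env.set (h : Env I σ) {x v : ℕ} (hx : 9 ≤ x) : Env I (σ.set x v) :=
  h.frame (p := assign x (.const v)) (frame_sem _ σ)
    (fun r hr => by simp only [wr, beq_eq_false_iff_ne]; omega) fun _ _ => rfl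

theorem Env.put (h : Env I σ) {a y v : ℕ} (ha : 3 ≤ a) : Env I (σ.put a y v) :=
  h.frame (p := store a (.const y) (.const v)) (frame_sem _ σ)
    (fun _ _ => rfl) fun r hr => by simp only [wm, beq_eq_false_iff_ne]; omega

theorem Rep.frame {p : FP} {a : ℕ} (h : Rep I σ a S) (hF : Frame p σ ρ) (hm : p.wm a = false) :
    Rep I ρ a S := by
  intro v hv
  rw [hF.mem a hm]
  exact h v hv

theorem Rep.set {a x v : ℕ} (h : Rep I σ a S) : Rep I (σ.set x v) a S := h

theorem Rep.holds {a x : ℕ} (h : Rep I σ a S) (hx : σ.reg x < I.n) :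
    (Expr.get a (.reg x)).Holds σ ↔ σ.reg x ∈ S := h _ hx

theorem Env.holds_adj (h : Env I σ) {x y : ℕ} (hx : σ.reg x < I.n) (hy : σ.reg y < I.n) :
    (adjE x y).Holds σ ↔ I.adj (σ.reg x) (σ.reg y) := h.adj _ hx _ hy

theorem Env.holds_out (h : Env I σ) {x y : ℕ} (hx : σ.reg x < I.n) (hy : σ.reg y < I.n) :
    (outE x y).Holds σ ↔ I.Out (σ.reg x) (σ.reg y) := by
  rw [outE, holds_and, h.holds_adj hx hy, holds_lt]
  simp [eval, h.ord _ hx, h.ord _ hy, Inst.Out]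

open Classical in
theorem count_mem_eq_card {n : ℕ} (h : S ⊆ Finset.range n) : Nat.count (· ∈ S) n = S.card := by
  rw [Nat.count_eq_card_filter_range]
  congr 1
  ext v
  simp only [Finset.mem_filter, and_iff_right_iff_imp]
  exact fun hv => h hv

/-- Decode register `26` into a set of later neighbours of the vertex in register `25`. The set is
left in array `5` and its cardinality in register `29`. -/
def decodeP : FP :=
  seq (assign 27 (.reg 26)) (seq (assign 29 (.const 0)) (loop 28 0
    (seq (store 5 (.reg 28) (.const 0)) (ite (outE 25 28)
      (seq (divMod 31 6 27 30 (.const 2))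
        (seq (ite (.reg 27) (seq (store 5 (.reg 28) (.const 1)) (incr 29)) skip)
          (assign 27 (.reg 30)))) skip))))

open Classical in
theorem sem_decodeP (hE : Env I σ) (hu : σ.reg 25 < I.n) (hs : σ.reg 26 < 2 ^ I.d) :
    Rep I (decodeP.sem σ) 5 (I.decode (σ.reg 25) (σ.reg 26)) ∧
      (decodeP.sem σ).reg 29 = (I.decode (σ.reg 25) (σ.reg 26)).card := by
  set u := σ.reg 25 with hu'
  set s := σ.reg 26 with hs'
  set σ₁ := (σ.set 27 s).set 29 0 with hσ₁
  have h0 : σ₁.reg 0 = I.n := by simp [hσ₁, hE.n]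
  have hE₁ : Env I σ₁ := (hE.set (by norm_num)).set (by norm_num)
  have := sem_loop (x := 28) (b := 0) (σ := σ₁) (p :=
    (seq (store 5 (.reg 28) (.const 0)) (ite (outE 25 28)
      (seq (divMod 31 6 27 30 (.const 2))
        (seq (ite (.reg 27) (seq (store 5 (.reg 28) (.const 1)) (incr 29)) skip)
          (assign 27 (.reg 30)))) skip)))
    (fun m ρ => ρ.reg 27 = s / 2 ^ I.rank u m ∧ (∀ v < m, ρ.mem 5 v ≠ 0 ↔ v ∈ I.decode u s) ∧
      ρ.reg 29 = Nat.count (· ∈ I.decode u s) m) (by simp [hσ₁, Inst.rank]) (by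
      rintro m ρ hm hx hF ⟨hz, hS, hc⟩
      rw [h0] at hm
      have hEρ : Env I ρ := hE₁.frame hF (by decide) (by decide)
      have h25 : ρ.reg 25 = u := by rw [hF.reg 25 rfl]; simp [hσ₁, hu']
      set ρ₁ := ρ.put 5 m 0 with hρ₁
      have hEρ₁ : Env I ρ₁ := hEρ.put (by norm_num)
      have hout : (outE 25 28).Holds ρ₁ ↔ I.Out u m := by
        rw [hEρ₁.holds_out] <;> simp [hρ₁, h25, hx, hu, hm]
      have hmem : m ∈ I.decode u s ↔ I.Out u m ∧ s / 2 ^ I.rank u m % 2 = 1 := by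
        simp [Inst.decode, hm]
      have hrank : I.rank u (m + 1) = I.rank u m + if I.Out u m then 1 else 0 := by
        simp only [Inst.rank, Nat.count_succ]
      simp only [sem, eval, hx]
      rw [← hρ₁]
      by_cases ho : I.Out u m
      -- A later neighbour consumes the lowest bit of register `27`.
      · have hne : (outE 25 28).eval ρ₁ ≠ 0 := hout.2 ho
        rw [if_pos hne]
        have hFD := frame_sem (divMod 31 6 27 30 (.const 2)) ρ₁
        obtain ⟨hD1, hD2⟩ := sem_divMod (x := 31) (b := 6) (z := 27) (q := 30) (e := .const 2)
          (σ := ρ₁) 2 (by norm_num) (by norm_num) (by norm_num) (by norm_num) (by norm_num)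
          (fun _ _ => rfl) (by
            have h27 : ρ₁.reg 27 = s / 2 ^ I.rank u m := hz
            rw [hEρ₁.two_pow, h27]
            exact (Nat.div_le_self _ _).trans hs.le)
        have h28 := hFD.reg 28 rfl
        have h29 := hFD.reg 29 rfl
        have h5 := hFD.mem 5 rfl
        set ρ₂ := (divMod 31 6 27 30 (.const 2)).sem ρ₁
        have h27 : ρ₁.reg 27 = s / 2 ^ I.rank u m := hz
        have h28' : ρ₁.reg 28 = m := hx
        have h29' : ρ₁.reg 29 = Nat.count (· ∈ I.decode u s) m := hc
        rw [h27] at hD1 hD2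
        have hq : ρ₂.reg 30 = s / 2 ^ I.rank u (m + 1) := by
          rw [hD2, hrank, if_pos ho, pow_succ, Nat.div_div_eq_div_mul]
        rw [hD1]
        rw [Nat.count_succ]
        by_cases hb : s / 2 ^ I.rank u m % 2 = 1
        · have hmd : m ∈ I.decode u s := hmem.2 ⟨ho, hb⟩
          rw [hb, if_pos one_ne_zero]
          simp only [incr, sem, eval, State.set_reg, State.set_mem, State.put_reg,
            State.put_mem_apply, h28, h28', h29, h29', h5, hq, hmd]
          refine ⟨by simp, fun v hv => ?_, by simp⟩
          rcases Nat.lt_succ_iff_lt_or_eq.1 hv with h | rfl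
          · simp [hρ₁, h.ne, hS v h]
          · simp [hmd]
        · have hmd : m ∉ I.decode u s := fun h => hb (hmem.1 h).2
          have hb0 : s / 2 ^ I.rank u m % 2 = 0 := by omega
          rw [hb0, if_neg (by simp)]
          simp only [State.set_reg, State.set_mem, h29, h29', h5, hq, hmd]
          refine ⟨by simp, fun v hv => ?_, by simp⟩
          rcases Nat.lt_succ_iff_lt_or_eq.1 hv with h | rfl
          · simp [hρ₁, h.ne, hS v h]
          · simp [hρ₁, hmd]
      · have hmd : m ∉ I.decode u s := fun h => ho (hmem.1 h).1
        have hne : ¬ (outE 25 28).eval ρ₁ ≠ 0 := fun h => ho (hout.1 h)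
        rw [if_neg hne, hrank, if_neg ho, Nat.count_succ, if_neg hmd]
        refine ⟨by simpa [hρ₁] using hz, fun v hv => ?_, by simpa [hρ₁] using hc⟩
        rcases Nat.lt_succ_iff_lt_or_eq.1 hv with h | rfl
        · simp [hρ₁, h.ne, hS v h]
        · simp [hρ₁, hmd])
  rw [h0, count_mem_eq_card ((Inst.decode_subset u s).trans (Inst.out_subset u))] at this
  exact ⟨this.2.1, this.2.2⟩

/-- For the set in array `5`, count its deleted elements in register `33`, and the remaining common
neighbours of its elements in register `32`. -/
def commonP : FP :=
  seq (count 34 0 33 skip (Expr.and (.get 5 (.reg 34)) (.get 3 (.reg 34))))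
    (count 37 0 32
      (count 35 0 36 skip (Expr.and (.get 5 (.reg 35)) (Expr.not (adjE 35 37))))
      (Expr.and (Expr.not (.get 3 (.reg 37))) (Expr.eq (.reg 36) (.const 0))))

theorem sem_commonP (hE : Env I σ) (hR : Rep I σ 3 R) (hS : Rep I σ 5 S)
    (hSn : S ⊆ Finset.range I.n) :
    ((commonP.sem σ).reg 33 = 0 ↔ ∀ v ∈ S, v ∉ R) ∧
      (commonP.sem σ).reg 32 = (I.common R S).card := by
  classical
  set p₁ := count 34 0 33 skip (Expr.and (.get 5 (.reg 34)) (.get 3 (.reg 34))) with hp₁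
  set p₂ := count 35 0 36 skip (Expr.and (.get 5 (.reg 35)) (Expr.not (adjE 35 37))) with hp₂
  set p₃ := count 37 0 32 p₂
    (Expr.and (Expr.not (.get 3 (.reg 37))) (Expr.eq (.reg 36) (.const 0))) with hp₃
  have h1 : (p₁.sem σ).reg 33 = Nat.count (fun v => v ∈ S ∧ v ∈ R) I.n := by
    rw [← hE.n]
    refine sem_count (x := 34) (b := 0) (c := 33) (p := skip) _ (by norm_num) (by norm_num) rfl
      fun m ρ hm hx hF => ?_
    rw [hE.n] at hm
    rw [sem, holds_and, (hS.frame hF rfl).holds (by omega), (hR.frame hF rfl).holds (by omega), hx]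
  set σ₁ := p₁.sem σ
  have hE₁ : Env I σ₁ := hE.sem (by decide) (by decide)
  have hR₁ : Rep I σ₁ 3 R := hR.frame (frame_sem _ _) rfl
  have hS₁ : Rep I σ₁ 5 S := hS.frame (frame_sem _ _) rfl
  have h2 : (p₃.sem σ₁).reg 32 = Nat.count (· ∈ I.common R S) I.n := by
    rw [← hE₁.n]
    refine sem_count (x := 37) (b := 0) (c := 32) (p := p₂) _ (by norm_num) (by norm_num) rfl
      fun w ρ hw hx hF => ?_
    rw [hE₁.n] at hw
    have hEρ : Env I ρ := hE₁.frame hF (by decide) (by decide)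
    have hRρ := hR₁.frame hF rfl
    have hSρ := hS₁.frame hF rfl
    have h3 : (p₂.sem ρ).reg 36 = Nat.count (fun v => v ∈ S ∧ ¬ I.adj v w) I.n := by
      rw [← hEρ.n]
      refine sem_count (x := 35) (b := 0) (c := 36) (p := skip) _ (by norm_num) (by norm_num) rfl
        fun v τ hv hx' hF' => ?_
      rw [hEρ.n] at hv
      have h37 : τ.reg 37 = w := by rw [hF'.reg 37 rfl, hx]
      have hEτ : Env I τ := hEρ.frame hF' (by decide) (by decide)
      rw [sem, holds_and, holds_not, (hSρ.frame hF' rfl).holds (by omega),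
        hEτ.holds_adj (by omega) (by omega), hx', h37]
    have h37 : (p₂.sem ρ).reg 37 = w := by rw [(frame_sem p₂ ρ).reg 37 rfl, hx]
    have hRp : Rep I (p₂.sem ρ) 3 R := hRρ.frame (frame_sem p₂ ρ) rfl
    rw [holds_and, holds_not, hRp.holds (by omega), holds_eq, h37]
    simp only [eval, h3, Nat.count_iff_forall_not, Inst.mem_common, hw, true_and, not_and, not_not]
    refine and_congr_right fun _ => ⟨fun h v hv => h v (Finset.mem_range.1 (hSn hv)) hv,
      fun h v _ hv => h v hv⟩
  have h33 : (commonP.sem σ).reg 33 = σ₁.reg 33 := (frame_sem p₃ σ₁).reg 33 rfl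
  constructor
  · rw [h33, h1, Nat.count_iff_forall_not]
    exact ⟨fun h v hv hvR => h v (Finset.mem_range.1 (hSn hv)) ⟨hv, hvR⟩,
      fun h v _ hv => h v hv.1 hv.2⟩
  · have hsub : I.common R S ⊆ Finset.range I.n := Finset.filter_subset _ _
    rw [← count_mem_eq_card hsub]
    exact h2

/-- Add the set in array `5` to the core in array `4`, and update its cardinality in
register `24`. -/
def unionP : FP :=
  loop 38 0 (ite (Expr.and (.get 5 (.reg 38)) (Expr.not (.get 4 (.reg 38))))
    (seq (store 4 (.reg 38) (.const 1)) (incr 24)) skip)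

theorem sem_unionP (hE : Env I σ) (hX : Rep I σ 4 X) (hS : Rep I σ 5 S)
    (hSn : S ⊆ Finset.range I.n) (hc : σ.reg 24 = X.card) :
    Rep I (unionP.sem σ) 4 (X ∪ S) ∧ (unionP.sem σ).reg 24 = (X ∪ S).card := by
  classical
  have := sem_loop (x := 38) (b := 0) (σ := σ)
    (p := ite (Expr.and (.get 5 (.reg 38)) (Expr.not (.get 4 (.reg 38))))
      (seq (store 4 (.reg 38) (.const 1)) (incr 24)) skip)
    (fun m ρ => Rep I ρ 4 (X ∪ S.filter (· < m)) ∧ ρ.reg 24 = (X ∪ S.filter (· < m)).card)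
    ⟨fun v hv => by simpa using hX v hv, by simp [hc]⟩ (by
      rintro m ρ hm hx hF ⟨hXρ, hcρ⟩
      rw [hE.n] at hm
      have hSρ := hS.frame hF rfl
      have hXm : m ∈ X ∪ S.filter (· < m) ↔ m ∈ X := by simp
      rw [sem_ite, holds_and, holds_not, hSρ.holds (by omega), hXρ.holds (by omega), hx, hXm]
      by_cases hin : m ∈ S ∧ m ∉ X
      · have hset : X ∪ S.filter (· < m + 1) = insert m (X ∪ S.filter (· < m)) := by
          ext v
          simp only [Finset.mem_union, Finset.mem_filter, Finset.mem_insert]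
          constructor
          · rintro (h | ⟨h, h'⟩)
            · exact .inr (.inl h)
            · rcases Nat.lt_succ_iff_lt_or_eq.1 h' with h' | h'
              · exact .inr (.inr ⟨h, h'⟩)
              · exact .inl h'
          · rintro (rfl | h | ⟨h, h'⟩)
            · exact .inr ⟨hin.1, by omega⟩
            · exact .inl h
            · exact .inr ⟨h, by omega⟩
        rw [if_pos hin, hset, Finset.card_insert_of_notMem (by rw [hXm]; exact hin.2), ← hcρ]
        refine ⟨fun v hv => ?_, by simp [incr, sem, eval]⟩
        simp only [incr, sem, eval, State.set_mem, State.put_mem_apply, hx, true_and,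
          Finset.mem_insert]
        split_ifs with h
        · simp [h]
        · rw [hXρ v hv]; simp [h]
      · have hset : X ∪ S.filter (· < m + 1) = X ∪ S.filter (· < m) := by
          ext v
          simp only [Finset.mem_union, Finset.mem_filter]
          constructor
          · rintro (h | ⟨h, h'⟩)
            · exact .inl h
            · rcases Nat.lt_succ_iff_lt_or_eq.1 h' with h' | rfl
              · exact .inr ⟨h, h'⟩
              · by_contra hcon
                exact hin ⟨h, fun h => hcon (.inl h)⟩
          · rintro (h | ⟨h, h'⟩)
            · exact .inl h
            · exact .inr ⟨h, by omega⟩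
        rw [if_neg hin, hset]
        exact ⟨hXρ, by simpa [sem] using hcρ⟩)
  have hfull : S.filter (· < σ.reg 0) = S := by
    rw [hE.n]
    exact Finset.filter_true_of_mem fun v hv => Finset.mem_range.1 (hSn hv)
  rw [hfull] at this
  exact this

/-- One greedy step of the computation of the core. -/
def coreStepP : FP :=
  seq decodeP (seq commonP (ite
    (Expr.and (Expr.eq (.reg 33) (.const 0)) (Expr.and
      (Expr.or (Expr.and (Expr.eq (.reg 29) (.reg 1)) (Expr.le (.reg 2) (.reg 32)))
        (Expr.and (Expr.eq (.reg 29) (.reg 2)) (Expr.le (.reg 1) (.reg 32))))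
      (Expr.le (.reg 24) (.reg 5)))) unionP skip))

theorem sem_coreStepP (hE : Env I σ) (hR : Rep I σ 3 R) (hX : Rep I σ 4 X)
    (hc : σ.reg 24 = X.card) (hu : σ.reg 25 < I.n) (hs : σ.reg 26 < 2 ^ I.d) :
    Rep I (coreStepP.sem σ) 4 (I.coreStep R X (I.decode (σ.reg 25) (σ.reg 26))) ∧
      (coreStepP.sem σ).reg 24 = (I.coreStep R X (I.decode (σ.reg 25) (σ.reg 26))).card := by
  classical
  obtain ⟨hS₁, h29⟩ := sem_decodeP hE hu hs
  set S := I.decode (σ.reg 25) (σ.reg 26)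
  have hSn : S ⊆ Finset.range I.n := (Inst.decode_subset _ _).trans (Inst.out_subset _)
  have hF := frame_sem decodeP σ
  have hE₁ := hE.frame hF (by decide) (by decide)
  have hR₁ := hR.frame hF rfl
  have hX₁ := hX.frame hF rfl
  have hc₁ := (hF.reg 24 rfl).trans hc
  rw [coreStepP, sem, sem]
  set σ₁ := decodeP.sem σ
  obtain ⟨h33, h32⟩ := sem_commonP hE₁ hR₁ hS₁ hSn
  have hF₂ := frame_sem commonP σ₁
  have hE₂ := hE₁.frame hF₂ (by decide) (by decide)
  have hX₂ := hX₁.frame hF₂ rfl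
  have hS₂ := hS₁.frame hF₂ rfl
  have hc₂ := (hF₂.reg 24 rfl).trans hc₁
  have h29₂ := (hF₂.reg 29 rfl).trans h29
  set σ₂ := commonP.sem σ₁
  have htest : (Expr.and (Expr.eq (.reg 33) (.const 0)) (Expr.and
      (Expr.or (Expr.and (Expr.eq (.reg 29) (.reg 1)) (Expr.le (.reg 2) (.reg 32)))
        (Expr.and (Expr.eq (.reg 29) (.reg 2)) (Expr.le (.reg 1) (.reg 32))))
      (Expr.le (.reg 24) (.reg 5)))).Holds σ₂ ↔ I.Bad R S ∧ X.card ≤ I.k * I.d := by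
    simp only [holds_and, holds_or, holds_eq, holds_le, eval, h29₂, h32, hE₂.i, hE₂.j, hE₂.kd,
      hc₂, h33, Inst.Bad, and_assoc]
  rw [sem_ite, Inst.coreStep]
  by_cases h : I.Bad R S ∧ X.card ≤ I.k * I.d
  · rw [if_pos (htest.2 h), if_pos h]
    exact sem_unionP hE₂ hX₂ hS₂ hSn hc₂
  · rw [if_neg (fun H => h (htest.1 H)), if_neg h]
    exact ⟨hX₂, hc₂⟩

/-- Compute the core for the deleted set in array `3`. It is left in array `4` and its cardinality
in register `24`. -/
def coreP : FP :=
  seq (clear 38 0 4) (seq (assign 24 (.const 0)) (loop 25 0 (loop 26 6 coreStepP)))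

theorem sem_coreP (hE : Env I σ) (hR : Rep I σ 3 R) :
    Rep I (coreP.sem σ) 4 (I.core R) ∧ (coreP.sem σ).reg 24 = (I.core R).card := by
  set σ₁ := ((clear 38 0 4).sem σ).set 24 0 with hσ₁
  have hFc := frame_sem (clear 38 0 4) σ
  have hE₁ : Env I σ₁ := (hE.frame hFc (by decide) (by decide)).set (by norm_num)
  have hR₁ : Rep I σ₁ 3 R := Rep.frame (ρ := (clear 38 0 4).sem σ) hR hFc rfl
  have h4 : ∀ v < I.n, σ₁.mem 4 v = 0 := fun v hv => sem_clear (hE.n.symm ▸ hv)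
  have h24 : σ₁.reg 24 = 0 := by simp [hσ₁]
  have := sem_loop (x := 25) (b := 0) (σ := σ₁) (p := loop 26 6 coreStepP)
    (fun m ρ => Rep I ρ 4 (I.coreUpTo R m) ∧ ρ.reg 24 = (I.coreUpTo R m).card)
    ⟨fun v hv => by simp [h4 v hv, Inst.coreUpTo], by simp [h24, Inst.coreUpTo]⟩ (by
      rintro u ρ hu hx hF ⟨hXρ, hcρ⟩
      rw [hE₁.n] at hu
      have hEρ := hE₁.frame hF (by decide) (by decide)
      have hRρ := hR₁.frame hF rfl
      have := sem_loop (x := 26) (b := 6) (σ := ρ) (p := coreStepP)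
        (fun m τ => Rep I τ 4 (I.coreRow R u (I.coreUpTo R u) m) ∧
          τ.reg 24 = (I.coreRow R u (I.coreUpTo R u) m).card)
        (by rw [Inst.coreRow]; exact ⟨hXρ.set, by simpa using hcρ⟩) (by
          rintro s τ hs hx' hF' ⟨hXτ, hcτ⟩
          rw [hEρ.two_pow] at hs
          have h25 : τ.reg 25 = u := (hF'.reg 25 rfl).trans hx
          have := sem_coreStepP (hEρ.frame hF' (by decide) (by decide)) (hRρ.frame hF' rfl)
            hXτ hcτ (by omega) (by omega)
          rw [h25, hx'] at this
          rw [Inst.coreRow]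
          exact ⟨this.1.set, by simpa using this.2⟩)
      rw [hEρ.two_pow] at this
      rw [Inst.coreUpTo]
      exact ⟨this.1.set, by simpa using this.2⟩)
  rw [hE₁.n] at this
  have e : coreP.sem σ = (loop 25 0 (loop 26 6 coreStepP)).sem σ₁ := by
    simp only [coreP, sem_seq, sem_assign, eval, hσ₁]
  rw [e]
  exact this

theorem Env.holds_adj_iff (hE : Env I σ) {x y z : ℕ} (hx : σ.reg x < I.n)
    (hy : σ.reg y < I.n)
    (hz : σ.reg z < I.n) : (Expr.eq (Expr.not (adjE x y)) (Expr.not (adjE x z))).Holds σ ↔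
      (I.adj (σ.reg x) (σ.reg y) ↔ I.adj (σ.reg x) (σ.reg z)) := by
  rw [← hE.holds_adj hx hy, ← hE.holds_adj hx hz, holds_eq]
  simp only [Expr.not, Holds, eval]
  omega

/-- Count the core vertices in register `43` that have the vertex in register `41` as a later
neighbour, and in register `47` the vertices that keep the vertex in register `41` from being the
first one with its neighbourhood in the core. -/
def classifyP : FP :=
  seq (count 42 0 43 skip (Expr.and (.get 4 (.reg 42)) (outE 42 41)))
    (count 46 0 47
      (count 44 0 45 skip (Expr.and (.get 4 (.reg 44))
        (Expr.not (Expr.eq (Expr.not (adjE 44 41)) (Expr.not (adjE 44 46))))))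
      (Expr.and (.lt (.reg 46) (.reg 41)) (Expr.and (Expr.not (.get 3 (.reg 46)))
        (Expr.and (Expr.not (.get 4 (.reg 46))) (Expr.eq (.reg 45) (.const 0))))))

theorem sem_classifyP (hE : Env I σ) (hR : Rep I σ 3 R) (hX : Rep I σ 4 X)
    (hXn : X ⊆ Finset.range I.n) (hv : σ.reg 41 < I.n) :
    (0 < (classifyP.sem σ).reg 43 ↔ ∃ x ∈ X, I.Out x (σ.reg 41)) ∧
      ((classifyP.sem σ).reg 47 = 0 ↔ I.IsRep R X (σ.reg 41)) := by
  classical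
  set v := σ.reg 41 with hvdef
  set p₁ := count 42 0 43 skip (Expr.and (.get 4 (.reg 42)) (outE 42 41)) with hp₁
  set p₂ := count 44 0 45 skip (Expr.and (.get 4 (.reg 44))
        (Expr.not (Expr.eq (Expr.not (adjE 44 41)) (Expr.not (adjE 44 46))))) with hp₂
  set p₃ := count 46 0 47 p₂
      (Expr.and (.lt (.reg 46) (.reg 41)) (Expr.and (Expr.not (.get 3 (.reg 46)))
        (Expr.and (Expr.not (.get 4 (.reg 46))) (Expr.eq (.reg 45) (.const 0))))) with hp₃
  have h1 : (p₁.sem σ).reg 43 = Nat.count (fun x => x ∈ X ∧ I.Out x v) I.n := by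
    rw [← hE.n]
    refine sem_count (x := 42) (b := 0) (c := 43) (p := skip) _ (by norm_num) (by norm_num) rfl
      fun m ρ hm hx hF => ?_
    rw [hE.n] at hm
    have h41 : ρ.reg 41 = v := hF.reg 41 rfl
    rw [sem, holds_and, (hX.frame hF rfl).holds (by omega),
      (hE.frame hF (by decide) (by decide)).holds_out (by omega) (by omega), hx, h41]
  set σ₁ := p₁.sem σ
  have hF₁ := frame_sem p₁ σ
  have hE₁ : Env I σ₁ := hE.frame hF₁ (by decide) (by decide)
  have hR₁ : Rep I σ₁ 3 R := hR.frame hF₁ rfl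
  have hX₁ : Rep I σ₁ 4 X := hX.frame hF₁ rfl
  have hv₁ : σ₁.reg 41 = v := hF₁.reg 41 rfl
  have h2 : (p₃.sem σ₁).reg 47 = Nat.count (fun w => w < v ∧ w ∉ R ∧ w ∉ X ∧
      ∀ x ∈ X, (I.adj x v ↔ I.adj x w)) I.n := by
    rw [← hE₁.n]
    refine sem_count (x := 46) (b := 0) (c := 47) (p := p₂) _ (by norm_num) (by norm_num) rfl
      fun w ρ hw hx hF => ?_
    rw [hE₁.n] at hw
    have hEρ : Env I ρ := hE₁.frame hF (by decide) (by decide)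
    have hXρ := hX₁.frame hF rfl
    have hvρ : ρ.reg 41 = v := (hF.reg 41 rfl).trans hv₁
    have h3 : (p₂.sem ρ).reg 45 =
        Nat.count (fun x => x ∈ X ∧ ¬ (I.adj x v ↔ I.adj x w)) I.n := by
      rw [← hEρ.n]
      refine sem_count (x := 44) (b := 0) (c := 45) (p := skip) _ (by norm_num) (by norm_num) rfl
        fun x τ hxn hx' hF' => ?_
      rw [hEρ.n] at hxn
      have h41 : τ.reg 41 = v := (hF'.reg 41 rfl).trans hvρ
      have h46 : τ.reg 46 = w := (hF'.reg 46 rfl).trans hx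
      rw [sem, holds_and, holds_not, (hXρ.frame hF' rfl).holds (by omega),
        (hEρ.frame hF' (by decide) (by decide)).holds_adj_iff (by omega) (by omega) (by omega),
        hx', h41, h46]
    have hF₂ := frame_sem p₂ ρ
    have h46 : (p₂.sem ρ).reg 46 = w := (hF₂.reg 46 rfl).trans hx
    have h41 : (p₂.sem ρ).reg 41 = v := (hF₂.reg 41 rfl).trans hvρ
    have hRp : Rep I (p₂.sem ρ) 3 R := (hR₁.frame hF rfl).frame hF₂ rfl
    have hXp : Rep I (p₂.sem ρ) 4 X := hXρ.frame hF₂ rfl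
    simp only [holds_and, holds_not, holds_lt, holds_eq, hRp.holds (x := 46) (by omega),
      hXp.holds (x := 46) (by omega), eval, h46, h41, h3, Nat.count_iff_forall_not, not_and,
      not_not]
    refine and_congr_right fun _ => and_congr_right fun _ => and_congr_right fun _ =>
      ⟨fun h x hx => h x (Finset.mem_range.1 (hXn hx)) hx, fun h x _ hx => h x hx⟩
  have h43 : (classifyP.sem σ).reg 43 = σ₁.reg 43 := (frame_sem p₃ σ₁).reg 43 rfl
  have h47 : (classifyP.sem σ).reg 47 = (p₃.sem σ₁).reg 47 := rfl
  constructor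
  · rw [h43, h1, Nat.pos_iff_ne_zero, Nat.count_ne_iff_exists]
    exact ⟨fun ⟨x, _, h⟩ => ⟨x, h⟩, fun ⟨x, hx, h⟩ => ⟨x, Finset.mem_range.1 (hXn hx), hx, h⟩⟩
  · rw [h47, h2, Nat.count_iff_forall_not, Inst.IsRep]
    constructor
    · intro h w hw hwR hwX
      have := h w (by omega)
      push Not at this
      obtain ⟨x, hx, h⟩ := this hw hwR hwX
      exact ⟨x, hx, by tauto⟩
    · rintro h w - ⟨hw, hwR, hwX, hall⟩
      obtain ⟨x, hx, hn⟩ := h w hw hwR hwX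
      exact hn (hall x hx)

/-- Put into register `40` the element of the branching set whose number is in register `23`. -/
def pickP : FP :=
  seq (assign 39 (.const 0)) (seq (assign 40 (.reg 0)) (loop 41 0
    (seq classifyP (ite (Expr.and (Expr.not (.get 3 (.reg 41)))
        (Expr.or (.get 4 (.reg 41))
          (Expr.or (.lt (.const 0) (.reg 43)) (Expr.eq (.reg 47) (.const 0)))))
      (seq (ite (Expr.eq (.reg 39) (.reg 23)) (assign 40 (.reg 41)) skip) (incr 39)) skip))))

open Classical in
theorem sem_pickP (hE : Env I σ) (hR : Rep I σ 3 R) (hX : Rep I σ 4 X)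
    (hXn : X ⊆ Finset.range I.n) :
    (pickP.sem σ).reg 40 = I.pickUpTo (I.branch R X) (σ.reg 23) I.n := by
  set g := σ.reg 23 with hg
  set L := I.branch R X with hL
  set σ₁ := (σ.set 39 0).set 40 (σ.reg 0) with hσ₁
  have hE₁ : Env I σ₁ := (hE.set (by norm_num)).set (by norm_num)
  have := sem_loop (x := 41) (b := 0) (σ := σ₁) (p :=
    (seq classifyP (ite (Expr.and (Expr.not (.get 3 (.reg 41)))
        (Expr.or (.get 4 (.reg 41))
          (Expr.or (.lt (.const 0) (.reg 43)) (Expr.eq (.reg 47) (.const 0)))))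
      (seq (ite (Expr.eq (.reg 39) (.reg 23)) (assign 40 (.reg 41)) skip) (incr 39)) skip)))
    (fun m ρ => ρ.reg 39 = Nat.count (· ∈ L) m ∧ ρ.reg 40 = I.pickUpTo L g m)
    (by simp [hσ₁, hE.n, Inst.pickUpTo]) (by
      rintro v ρ hv hx hF ⟨h39, h40⟩
      rw [hE₁.n] at hv
      have hEρ := hE₁.frame hF (by decide) (by decide)
      have hRρ : Rep I ρ 3 R := Rep.frame (σ := σ₁) hR hF rfl
      have hXρ : Rep I ρ 4 X := Rep.frame (σ := σ₁) hX hF rfl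
      obtain ⟨hc1, hc2⟩ := sem_classifyP hEρ hRρ hXρ hXn (by omega)
      have hF' := frame_sem classifyP ρ
      have hR' := hRρ.frame hF' rfl
      have hX' := hXρ.frame hF' rfl
      have h41 := (hF'.reg 41 rfl).trans hx
      have h23 : (classifyP.sem ρ).reg 23 = g := by
        rw [hF'.reg 23 rfl, hF.reg 23 rfl]; simp [hσ₁, hg]
      have h39' := (hF'.reg 39 rfl).trans h39
      have h40' := (hF'.reg 40 rfl).trans h40
      rw [sem]
      set τ := classifyP.sem ρ
      have htest : (Expr.and (Expr.not (.get 3 (.reg 41))) (Expr.or (.get 4 (.reg 41))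
          (Expr.or (.lt (.const 0) (.reg 43)) (Expr.eq (.reg 47) (.const 0))))).Holds τ ↔
          v ∈ L := by
        simp only [holds_and, holds_not, holds_or, holds_lt, holds_eq, hR'.holds (x := 41)
          (by omega), hX'.holds (x := 41) (by omega), eval, hc1, hc2, h41, hx, hL, Inst.branch,
          Finset.mem_filter, Finset.mem_range, hv, true_and]
      rw [sem_ite, Nat.count_succ, Inst.pickUpTo]
      by_cases hvL : v ∈ L
      · rw [if_pos (htest.2 hvL), if_pos hvL, sem, sem_ite]
        have ht : (Expr.eq (.reg 39) (.reg 23)).Holds τ ↔ Nat.count (· ∈ L) v = g := by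
          simp [eval, h39', h23]
        by_cases hcg : Nat.count (· ∈ L) v = g
        · rw [if_pos (ht.2 hcg), if_pos ⟨hvL, hcg⟩]
          simp [incr, sem, eval, h39', h41]
        · rw [if_neg (fun H => hcg (ht.1 H)), if_neg (fun H => hcg H.2)]
          simp [incr, sem, eval, h39', h40']
      · rw [if_neg (fun H => hvL (htest.1 H)), if_neg hvL, if_neg (fun H => hvL H.1)]
        simp [sem, h39', h40'])
  rw [hE₁.n] at this
  exact this.2

/-- One branching step. The choices that are still to be made are encoded in register `21`. -/
def nextP : FP :=
  seq coreP (seq (divMod 31 8 21 48 (.reg 7)) (seq (assign 23 (.reg 21))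
    (seq (assign 21 (.reg 48)) (seq pickP (store 3 (.reg 40) (.const 1))))))

theorem sem_nextP (hE : Env I σ) (hR : Rep I σ 3 R) (hY : σ.reg 21 ≤ I.base ^ I.k) :
    Rep I (nextP.sem σ) 3 (I.next R (σ.reg 21 % I.base)) ∧
      (nextP.sem σ).reg 21 = σ.reg 21 / I.base := by
  obtain ⟨hX, -⟩ := sem_coreP hE hR
  have hF₁ := frame_sem coreP σ
  have hE₁ := hE.frame hF₁ (by decide) (by decide)
  have hR₁ := hR.frame hF₁ rfl
  have h21 := hF₁.reg 21 rfl
  set σ₁ := coreP.sem σ with hσ₁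
  obtain ⟨hD1, hD2⟩ := sem_divMod (x := 31) (b := 8) (z := 21) (q := 48) (e := .reg 7)
    (σ := σ₁) I.base Inst.base_pos (by norm_num) (by norm_num) (by norm_num) (by norm_num)
    (fun ρ hF => (hF.reg 7 rfl).trans hE₁.base) (by rw [hE₁.base_pow, h21]; exact hY)
  have hF₂ := frame_sem (divMod 31 8 21 48 (.reg 7)) σ₁
  have hE₂ := hE₁.frame hF₂ (by decide) (by decide)
  have hR₂ := hR₁.frame hF₂ rfl
  have hX₂ := hX.frame hF₂ rfl
  set σ₂ := (divMod 31 8 21 48 (.reg 7)).sem σ₁ with hσ₂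
  set σ₃ := (σ₂.set 23 (σ₂.reg 21)).set 21 (σ₂.reg 48) with hσ₃
  have hE₃ : Env I σ₃ := (hE₂.set (by norm_num)).set (by norm_num)
  have h23 : σ₃.reg 23 = σ.reg 21 % I.base := by simp [hσ₃, hD1, h21]
  have hpick := sem_pickP (σ := σ₃) hE₃ hR₂ hX₂ Inst.core_subset
  have hF₄ := frame_sem pickP σ₃
  have hR₄ : Rep I (pickP.sem σ₃) 3 R := Rep.frame (σ := σ₃) hR₂ hF₄ rfl
  have e : nextP.sem σ = (pickP.sem σ₃).put 3 ((pickP.sem σ₃).reg 40) 1 := by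
    simp [nextP, sem, eval, hσ₃, ← hσ₁, ← hσ₂]
  rw [e, hpick, h23]
  constructor
  · intro v hv
    rw [State.put_mem_apply, Inst.next, Finset.mem_insert]
    split_ifs with h
    · simp [h.2]
    · rw [hR₄ v hv]
      simp only [true_and] at h
      simp [h]
  · rw [State.put_reg, hF₄.reg 21 rfl]
    simp [hσ₃, hD2, h21]

/-- Follow the branch that is encoded in register `20`, and write `1` into register `49` if no
biclique is left at its end. -/
def trialP : FP :=
  seq (clear 38 0 3) (seq (assign 21 (.reg 20)) (seq (loop 22 3 nextP) (seq coreP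
    (ite (Expr.eq (.reg 24) (.const 0)) (assign 49 (.const 1)) skip))))

open Classical in
theorem sem_trialP (hE : Env I σ) (hy : σ.reg 20 ≤ I.base ^ I.k) :
    (trialP.sem σ).reg 49 =
      if I.core (I.run I.k (σ.reg 20) ∅) = ∅ then 1 else σ.reg 49 := by
  set y := σ.reg 20 with hydef
  have hFc := frame_sem (clear 38 0 3) σ
  have h20 := hFc.reg 20 rfl
  set σ₁ := ((clear 38 0 3).sem σ).set 21 y with hσ₁
  have hE₁ : Env I σ₁ := (hE.frame hFc (by decide) (by decide)).set (by norm_num)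
  have h3 : Rep I σ₁ 3 ∅ := fun v hv => by
    have : σ₁.mem 3 v = 0 := sem_clear (hE.n.symm ▸ hv)
    simp [this]
  have h49 : σ₁.reg 49 = σ.reg 49 := by
    rw [hσ₁, State.set_reg, if_neg (by norm_num), hFc.reg 49 rfl]
  have := sem_loop (x := 22) (b := 3) (σ := σ₁) (p := nextP)
    (fun m ρ => m ≤ I.k → ∃ R, Rep I ρ 3 R ∧ ρ.reg 21 ≤ I.base ^ I.k ∧
      I.run (I.k - m) (ρ.reg 21) R = I.run I.k y ∅)
    (fun _ => ⟨∅, h3, by simpa [hσ₁] using hy, by simp [hσ₁]⟩) (by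
      intro m ρ hm hx hF hI _
      rw [hE₁.k] at hm
      obtain ⟨R, hR, hY, hrun⟩ := hI hm.le
      obtain ⟨hR', h21⟩ := sem_nextP (hE₁.frame hF (by decide) (by decide)) hR hY
      refine ⟨_, hR'.set, ?_, ?_⟩
      · simp only [State.set_reg]
        rw [if_neg (by norm_num), h21]
        exact (Nat.div_le_self _ _).trans hY
      · simp only [State.set_reg]
        rw [if_neg (by norm_num), h21, ← hrun]
        obtain ⟨l, hl⟩ : ∃ l, I.k - m = l + 1 := ⟨I.k - m - 1, by omega⟩
        have hl' : I.k - (m + 1) = l := by omega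
        rw [hl, hl', Inst.run])
  rw [hE₁.k] at this
  obtain ⟨R, hR, -, hrun⟩ := this le_rfl
  simp only [Nat.sub_self, Inst.run] at hrun
  subst hrun
  have hF₂ := frame_sem (loop 22 3 nextP) σ₁
  have hE₂ := hE₁.frame hF₂ (by decide) (by decide)
  have e : trialP.sem σ = (ite (Expr.eq (.reg 24) (.const 0)) (assign 49 (.const 1)) skip).sem
      (coreP.sem ((loop 22 3 nextP).sem σ₁)) := by
    simp only [trialP, sem_seq, sem_assign, eval, h20, hσ₁, hydef]
  set σ₂ := (loop 22 3 nextP).sem σ₁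
  obtain ⟨-, h24⟩ := sem_coreP hE₂ hR
  have hF₃ := frame_sem coreP σ₂
  have h49' : (coreP.sem σ₂).reg 49 = σ.reg 49 := by
    rw [hF₃.reg 49 rfl, hF₂.reg 49 rfl, h49]
  rw [e, sem_ite, holds_eq]
  simp only [eval, h24, Finset.card_eq_zero]
  split_ifs with h
  · simp [sem, eval]
  · simp [sem, h49']

/-- Follow all branches, and leave the answer in register `49`. -/
def searchP : FP := seq (assign 49 (.const 0)) (loop 20 8 trialP)

open Classical in
theorem sem_searchP (hE : Env I σ) :
    (searchP.sem σ).reg 49 = if I.Yes ∅ I.k then 1 else 0 := by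
  have hE₁ : Env I (σ.set 49 0) := hE.set (by norm_num)
  have := sem_loop (x := 20) (b := 8) (σ := σ.set 49 0) (p := trialP)
    (fun m ρ => ρ.reg 49 = if ∃ y < m, I.core (I.run I.k y ∅) = ∅ then 1 else 0)
    (by simp) (by
      intro m ρ hm hx hF hI
      rw [hE₁.base_pow] at hm
      have ht := sem_trialP (hE₁.frame hF (by decide) (by decide)) (by omega)
      rw [State.set_reg, if_neg (by norm_num), ht, hx, hI]
      have hiff : (∃ y < m + 1, I.core (I.run I.k y ∅) = ∅) ↔
          I.core (I.run I.k m ∅) = ∅ ∨ ∃ y < m, I.core (I.run I.k y ∅) = ∅ := by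
        constructor
        · rintro ⟨y, hy, h⟩
          rcases Nat.lt_succ_iff_lt_or_eq.1 hy with hy | rfl
          · exact .inr ⟨y, hy, h⟩
          · exact .inl h
        · rintro (h | ⟨y, hy, h⟩)
          · exact ⟨m, by omega, h⟩
          · exact ⟨y, by omega, h⟩
      by_cases h1 : I.core (I.run I.k m ∅) = ∅
      · rw [if_pos h1, if_pos (hiff.2 (.inl h1))]
      · simp only [hiff, h1, false_or, if_false])
  simp only [hE₁.base_pow, Inst.exists_run_iff] at this
  exact this

theorem searchP_ok : searchP.ok = true := by decide

end RAM.FP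

/-! ### Peeling off vertices of small degree -/

namespace BFVD

open Finset

/-- The state of the peeling process on a graph with vertices below `n` and adjacency relation `A`:
the positions `o` of the vertices removed so far (`0` for the others), the next position `c`, and
the degree bound `d`, which never exceeds `δ`. -/
structure Peel (n : ℕ) (A : ℕ → ℕ → Prop) (δ : ℕ) (o : ℕ → ℕ) (c d : ℕ) : Prop where
  lt : ∀ v < n, o v < c
  inj : ∀ u < n, ∀ v < n, o u ≠ 0 → o u = o v → u = v
  out : ∀ u < n, o u ≠ 0 → ∀ S : Finset ℕ,
    (∀ w ∈ S, A u w ∧ (o w = 0 ∨ o u < o w)) → #S ≤ d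
  card : #{v ∈ range n | o v ≠ 0} + 1 = c
  d_le : d ≤ δ

variable {n : ℕ} {A : ℕ → ℕ → Prop} {δ : ℕ} {o : ℕ → ℕ} {c d : ℕ}

/-- A vertex with at most `d` remaining neighbours may be removed. -/
theorem Peel.remove (h : Peel n A δ o c d) (hA : ∀ {u v}, A u v → v < n) {f : ℕ} (hf : f < n)
    (hof : o f = 0) (hdeg : ∀ S : Finset ℕ, (∀ w ∈ S, A f w ∧ o w = 0) → #S ≤ d) :
    Peel n A δ (Function.update o f c) (c + 1) d := by
  have hc : 0 < c := by have := h.card; omega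
  constructor
  · intro v hv
    have := h.lt v hv
    rw [Function.update_apply]
    split_ifs <;> omega
  · intro u hu v hv
    have h1 := h.lt u hu
    have h2 := h.lt v hv
    simp only [Function.update_apply]
    split_ifs with h3 h4 h4
    · exact fun _ _ => h3.trans h4.symm
    · exact fun _ _ => by omega
    · exact fun _ _ => by omega
    · exact h.inj u hu v hv
  · intro u hu hne S hS
    by_cases huf : u = f
    · subst huf
      refine hdeg S fun w hw => ⟨(hS w hw).1, ?_⟩
      have h1 := (hS w hw).2
      have h2 := h.lt w (hA (hS w hw).1)
      simp only [Function.update_apply, if_true] at h1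
      split_ifs at h1 <;> omega
    · rw [Function.update_of_ne huf] at hne
      refine h.out u hu hne S fun w hw => ⟨(hS w hw).1, ?_⟩
      have h1 := (hS w hw).2
      simp only [Function.update_apply, if_neg huf] at h1
      split_ifs at h1 with h2
      · exact .inl (h2 ▸ hof)
      · exact h1
  · have hset : {v ∈ range n | Function.update o f c v ≠ 0} =
        insert f {v ∈ range n | o v ≠ 0} := by
      ext v
      simp only [mem_filter, mem_range, mem_insert, Function.update_apply]
      split_ifs with h1
      · simp only [h1, hf, true_and, true_or, iff_true]; omega
      · simp [h1]
    rw [hset, card_insert_of_notMem (by simp [hof]), h.card]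
  · exact h.d_le

theorem Peel.exists_eq_zero (h : Peel n A δ o c d) (hc : c ≤ n) : ∃ v < n, o v = 0 := by
  by_contra! hcon
  have h1 : {v ∈ range n | o v ≠ 0} = range n :=
    filter_true_of_mem fun v hv => hcon v (mem_range.1 hv)
  have := h.card
  rw [h1, card_range] at this
  omega

theorem Peel.ne_zero (h : Peel n A δ o c d) (hc : n < c) : ∀ v < n, o v ≠ 0 := by
  have h1 : {v ∈ range n | o v ≠ 0} = range n := by
    refine eq_of_subset_of_card_le (filter_subset _ _) ?_
    have := h.card
    rw [card_range]
    omega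
  exact fun v hv => (filter_eq_self.1 h1) v (mem_range.2 hv)

theorem Peel.raise (h : Peel n A δ o c d) (hd : d + 1 ≤ δ) : Peel n A δ o c (d + 1) :=
  ⟨h.lt, h.inj, fun u hu hne S hS => (h.out u hu hne S hS).trans (Nat.le_succ _), h.card, hd⟩

end BFVD

/-! ### The preparatory program -/

namespace RAM.FP

open BFVD RAM.Expr

variable {n : ℕ} {A : ℕ → ℕ → Prop} {δ : ℕ} {σ ρ : State}

/-- Register `0` holds the number of vertices, and arrays `0` and `1` the adjacency matrix. -/
structure MatEnv (n : ℕ) (A : ℕ → ℕ → Prop) (σ : State) : Prop where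
  reg_zero : σ.reg 0 = n
  adj : ∀ u < n, ∀ v < n, σ.mem 0 (σ.mem 1 u + v) ≠ 0 ↔ A u v

theorem MatEnv.frame {p : FP} (h : MatEnv n A σ) (hF : Frame p σ ρ) (h0 : p.wr 0 = false)
    (h1 : p.wm 0 = false) (h2 : p.wm 1 = false) : MatEnv n A ρ := by
  constructor
  · rw [hF.reg 0 h0, h.reg_zero]
  · rw [hF.mem 0 h1, hF.mem 1 h2]; exact h.adj

/-- Find a vertex that has not been removed and that has at most as many remaining neighbours as
register `4` says. It is put into register `55`, which is `n` if there is none. -/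
def findP : FP :=
  seq (assign 55 (.reg 0)) (loop 56 0
    (seq (count 57 0 58 skip
        (Expr.and (adjE 56 57) (Expr.eq (.get 2 (.reg 57)) (.const 0))))
      (ite (Expr.and (Expr.eq (.get 2 (.reg 56)) (.const 0)) (Expr.le (.reg 58) (.reg 4)))
        (assign 55 (.reg 56)) skip)))

open Classical in
theorem sem_findP (hE : MatEnv n A σ) (f : ℕ) (hf : (findP.sem σ).reg 55 = f) :
    (f < n → σ.mem 2 f = 0 ∧ Nat.count (fun w => A f w ∧ σ.mem 2 w = 0) n ≤ σ.reg 4) ∧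
    (¬ f < n → ∀ v < n, σ.mem 2 v = 0 →
      ¬ Nat.count (fun w => A v w ∧ σ.mem 2 w = 0) n ≤ σ.reg 4) := by
  set cond : ℕ → Prop := fun v =>
    σ.mem 2 v = 0 ∧ Nat.count (fun w => A v w ∧ σ.mem 2 w = 0) n ≤ σ.reg 4 with hcond
  set p₁ := count 57 0 58 skip
    (Expr.and (adjE 56 57) (Expr.eq (.get 2 (.reg 57)) (.const 0))) with hp₁
  set σ₁ := σ.set 55 (σ.reg 0) with hσ₁
  have hE₁ : MatEnv n A σ₁ := ⟨by simp [hσ₁, hE.reg_zero], hE.adj⟩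
  have := sem_loop (x := 56) (b := 0) (σ := σ₁) (p :=
      seq p₁ (ite (Expr.and (Expr.eq (.get 2 (.reg 56)) (.const 0)) (Expr.le (.reg 58) (.reg 4)))
        (assign 55 (.reg 56)) skip))
    (fun m ρ => (ρ.reg 55 < n → cond (ρ.reg 55)) ∧ (¬ ρ.reg 55 < n → ∀ v < m, ¬ cond v))
    (by simp [hσ₁, hE.reg_zero]) (by
      rintro m ρ hm hx hF ⟨hI1, hI2⟩
      rw [hE₁.reg_zero] at hm
      have hEρ := hE₁.frame hF rfl rfl rfl
      have h2ρ : ρ.mem 2 = σ.mem 2 := hF.mem 2 rfl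
      have h4ρ : ρ.reg 4 = σ.reg 4 := by rw [hF.reg 4 rfl]; simp [hσ₁]
      have h58 : (p₁.sem ρ).reg 58 = Nat.count (fun w => A m w ∧ σ.mem 2 w = 0) n := by
        rw [← hEρ.reg_zero]
        refine sem_count (x := 57) (b := 0) (c := 58) (p := skip) _ (by norm_num) (by norm_num) rfl
          fun w τ hw hx' hF' => ?_
        rw [hEρ.reg_zero] at hw
        have hEτ := hEρ.frame hF' rfl rfl rfl
        have h56 : τ.reg 56 = m := (hF'.reg 56 rfl).trans hx
        have h2τ : τ.mem 2 = σ.mem 2 := (hF'.mem 2 rfl).trans h2ρ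
        have hadj : (adjE 56 57).Holds τ ↔ A m w := by
          have := hEτ.adj m hm w hw
          rwa [← h56, ← hx'] at this ⊢
        rw [sem, holds_and, hadj, holds_eq]
        simp [eval, hx', h2τ]
      have hF₁ := frame_sem p₁ ρ
      have h56 := (hF₁.reg 56 rfl).trans hx
      have h2 := (hF₁.mem 2 rfl).trans h2ρ
      have h4 := (hF₁.reg 4 rfl).trans h4ρ
      have h55 := hF₁.reg 55 rfl
      have htest : (Expr.and (Expr.eq (.get 2 (.reg 56)) (.const 0))
          (Expr.le (.reg 58) (.reg 4))).Holds (p₁.sem ρ) ↔ cond m := by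
        simp [eval, h58, h56, h2, h4, hcond]
      rw [sem, sem_ite]
      by_cases hc : cond m
      · rw [if_pos (htest.2 hc)]
        simp [sem, eval, h56, hc, hm]
      · rw [if_neg (fun H => hc (htest.1 H))]
        simp only [sem, State.set_reg, h55]
        refine ⟨by simpa using hI1, fun h v hv => ?_⟩
        rcases Nat.lt_succ_iff_lt_or_eq.1 hv with hv | rfl
        · exact hI2 (by simpa using h) v hv
        · exact hc)
  rw [hE₁.reg_zero] at this
  have e : findP.sem σ = (loop 56 0 (seq p₁
      (ite (Expr.and (Expr.eq (.get 2 (.reg 56)) (.const 0)) (Expr.le (.reg 58) (.reg 4)))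
        (assign 55 (.reg 56)) skip))).sem σ₁ := by
    simp only [findP, sem_seq, sem_assign, eval, hσ₁, hp₁]
  rw [← e, hf] at this
  exact ⟨this.1, fun h v hv h0 hc => this.2 h v hv ⟨h0, hc⟩⟩

/-- Remove a vertex, or raise the degree bound in register `4` if this is impossible. -/
def peelStepP : FP :=
  seq findP (ite (.lt (.reg 55) (.reg 0))
    (seq (store 2 (.reg 55) (.reg 53)) (incr 53))
    (ite (Expr.le (.reg 53) (.reg 0)) (incr 4) skip))

theorem card_le_count {n : ℕ} {P : ℕ → Prop} [DecidablePred P] {S : Finset ℕ}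
    (h : ∀ w ∈ S, P w ∧ w < n) :
    S.card ≤ Nat.count P n := by
  rw [Nat.count_eq_card_filter_range]
  exact Finset.card_le_card fun w hw =>
    Finset.mem_filter.2 ⟨Finset.mem_range.2 (h w hw).2, (h w hw).1⟩

open Classical in
/-- One round keeps the peeling invariant, and makes progress unless everything has been removed. -/
theorem peel_peelStepP (hE : MatEnv n A σ) (hA : ∀ {u v}, A u v → v < n)
    (hδ : ∀ P : ℕ → Prop, (∃ v < n, P v) → ∃ v < n, P v ∧ ∀ S : Finset ℕ,
      (∀ w ∈ S, A v w ∧ P w) → S.card ≤ δ)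
    (h : Peel n A δ (σ.mem 2) (σ.reg 53) (σ.reg 4)) :
    Peel n A δ ((peelStepP.sem σ).mem 2) ((peelStepP.sem σ).reg 53) ((peelStepP.sem σ).reg 4) ∧
      (σ.reg 53 + σ.reg 4 < (peelStepP.sem σ).reg 53 + (peelStepP.sem σ).reg 4 ∨
        n < (peelStepP.sem σ).reg 53) := by
  obtain ⟨hf1, hf2⟩ := sem_findP hE _ rfl
  have hF := frame_sem findP σ
  have h0 := (hF.reg 0 rfl).trans hE.reg_zero
  have h53 := hF.reg 53 rfl
  have h4 := hF.reg 4 rfl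
  have h2 := hF.mem 2 rfl
  rw [peelStepP, sem]
  set τ := findP.sem σ
  rw [sem_ite, holds_lt]
  simp only [eval, h0]
  by_cases hlt : τ.reg 55 < n
  · rw [if_pos hlt]
    obtain ⟨hz, hc⟩ := hf1 hlt
    have := h.remove hA hlt hz fun S hS =>
      (card_le_count fun w hw => ⟨hS w hw, hA (hS w hw).1⟩).trans hc
    simp only [incr, sem, eval, State.set_reg, State.put_reg, State.set_mem, State.put_mem, h53,
      h4, h2, if_true]
    norm_num
    exact this
  · rw [if_neg hlt, sem_ite, holds_le]
    simp only [eval, h0, h53]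
    by_cases hle : σ.reg 53 ≤ n
    · rw [if_pos hle]
      -- Some remaining vertex has at most `δ` remaining neighbours, but none has at
      -- most as many as the current bound.
      have hd : σ.reg 4 + 1 ≤ δ := by
        obtain ⟨v, hv, hvz, hvS⟩ := hδ (fun v => σ.mem 2 v = 0) (h.exists_eq_zero hle)
        have h1 := hf2 hlt v hv hvz
        rw [Nat.count_eq_card_filter_range] at h1
        exact (not_le.1 h1).trans_le (hvS _ fun w hw => (Finset.mem_filter.1 hw).2)
      simp only [incr, sem, eval, State.set_reg, State.set_mem, h53, h4, h2, if_true]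
      norm_num
      exact h.raise hd
    · rw [if_neg hle]
      simp only [sem, h53, h4, h2]
      exact ⟨h, .inr (not_le.1 hle)⟩

/-- Compute the offsets of the rows of the adjacency matrix in array `1`. -/
def rowsP : FP :=
  seq (assign 51 (.const 0)) (loop 52 0
    (seq (store 1 (.reg 52) (.reg 51)) (assign 51 (.add (.reg 51) (.reg 0)))))

theorem sem_rowsP (hn : σ.reg 0 = n) : ∀ u < n, (rowsP.sem σ).mem 1 u = u * n := by
  have := sem_loop (x := 52) (b := 0) (σ := σ.set 51 0)
    (p := seq (store 1 (.reg 52) (.reg 51)) (assign 51 (.add (.reg 51) (.reg 0))))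
    (fun m ρ => ρ.reg 51 = m * n ∧ ∀ u < m, ρ.mem 1 u = u * n) (by simp) (by
      rintro m ρ hm hx hF ⟨h1, h2⟩
      have h0 : ρ.reg 0 = n := by rw [hF.reg 0 rfl]; simp [hn]
      refine ⟨by simp [sem, eval, h1, h0, add_mul], fun u hu => ?_⟩
      simp only [sem, eval, State.set_mem, State.put_mem_apply, hx, h1, true_and]
      split_ifs with h
      · rw [h]
      · exact h2 u (by omega))
  have h0 : (σ.set 51 0).reg 0 = n := by simp [hn]
  rw [h0] at this
  exact this.2

/-- Order the vertices by removing vertices of small degree one by one. The positions are written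
into array `2`, the final degree bound into register `4`, and six times this bound into
register `9`. -/
def peelP : FP :=
  seq (assign 4 (.const 0)) (seq (assign 53 (.const 1)) (seq (loop 54 50 peelStepP)
    (assign 9 (.add (.add (.add (.reg 4) (.reg 4)) (.add (.reg 4) (.reg 4)))
      (.add (.reg 4) (.reg 4))))))

theorem sem_peelP (hE : MatEnv n A σ) (hA : ∀ {u v}, A u v → v < n)
    (hδ : ∀ P : ℕ → Prop, (∃ v < n, P v) → ∃ v < n, P v ∧ ∀ S : Finset ℕ,
      (∀ w ∈ S, A v w ∧ P w) → S.card ≤ δ) (hδn : δ ≤ n)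
    (h50 : σ.reg 50 = n + n) (h2 : ∀ v, σ.mem 2 v = 0) :
    (∃ c, n < c ∧ Peel n A δ ((peelP.sem σ).mem 2) c ((peelP.sem σ).reg 4)) ∧
      (peelP.sem σ).reg 9 = 6 * (peelP.sem σ).reg 4 := by
  set σ₁ := (σ.set 4 0).set 53 1 with hσ₁
  have hE₁ : MatEnv n A σ₁ := ⟨by simp [hσ₁, hE.reg_zero], hE.adj⟩
  have h50' : σ₁.reg 50 = n + n := by simp [hσ₁, h50]
  have := sem_loop (x := 54) (b := 50) (σ := σ₁) (p := peelStepP)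
    (fun m ρ => Peel n A δ (ρ.mem 2) (ρ.reg 53) (ρ.reg 4) ∧
      (m < ρ.reg 53 + ρ.reg 4 ∨ n < ρ.reg 53))
    (by
      refine ⟨?_, by simp [hσ₁]⟩
      constructor <;> simp [hσ₁, h2]) (by
      rintro m ρ hm hx hF ⟨hP, hm'⟩
      obtain ⟨hP', hlt⟩ := peel_peelStepP (hE₁.frame hF rfl rfl rfl) hA hδ hP
      have h53 : ρ.reg 53 ≤ (peelStepP.sem ρ).reg 53 := by
        have h53' := (frame_sem findP ρ).reg 53 rfl
        rw [peelStepP, sem, sem_ite, sem_ite]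
        split_ifs <;> simp [incr, sem, eval, h53']
      simp only [State.set_mem, State.set_reg]
      norm_num
      refine ⟨hP', ?_⟩
      omega)
  rw [h50'] at this
  obtain ⟨hP, hc⟩ := this
  set τ := (loop 54 50 peelStepP).sem σ₁ with hτ
  have e : peelP.sem σ = τ.set 9 (τ.reg 4 + τ.reg 4 + (τ.reg 4 + τ.reg 4) +
      (τ.reg 4 + τ.reg 4)) := by
    simp only [peelP, sem_seq, sem_assign, eval, hτ, hσ₁]
  rw [e]
  refine ⟨⟨τ.reg 53, ?_, by simpa using hP⟩, by simp; ring⟩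
  -- Each of the `2 * n` rounds raises `c` or `d`, and `d ≤ δ ≤ n`, so that `c` exceeds `n`.
  rcases hc with hc | hc
  · have := hP.d_le
    omega
  · exact hc

/-- Double register `x`. -/
def dbl (x : ℕ) : FP := assign x (.add (.reg x) (.reg x))

/-- Compute the remaining quantities that describe the instance. -/
def powersP : FP :=
  seq (seq (assign 5 (.const 0)) (loop 59 3 (assign 5 (.add (.reg 5) (.reg 4)))))
    (seq (seq (assign 6 (.const 1)) (loop 59 4 (dbl 6)))
      (seq (seq (assign 7 (.const 1)) (loop 59 3 (loop 60 9 (dbl 7))))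
        (seq (assign 8 (.const 1)) (loop 61 3 (loop 59 3 (loop 60 9 (dbl 8)))))))

theorem sem_dbl (x : ℕ) (σ : State) : ((dbl x).sem σ).reg x = σ.reg x * 2 := by
  simp [dbl, sem, eval, mul_two]

theorem sem_powersP {k d q : ℕ} (hk : σ.reg 3 = k) (hd : σ.reg 4 = d) (hq : σ.reg 9 = q) :
    (powersP.sem σ).reg 5 = k * d ∧ (powersP.sem σ).reg 6 = 2 ^ d ∧
      (powersP.sem σ).reg 7 = 2 ^ (k * q) ∧ (powersP.sem σ).reg 8 = (2 ^ (k * q)) ^ k := by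
  have key : ∀ (r : ℕ) (τ : State), r ≠ 60 → r ≠ 9 → τ.reg 9 = q →
      ((loop 60 9 (dbl r)).sem τ).reg r = τ.reg r * 2 ^ q := by
    intro r τ h1 h2 h9
    rw [sem_loop_mul 2 h1 fun ρ _ => sem_dbl r ρ, h9]
  have key2 : ∀ (r : ℕ) (τ : State), r ≠ 59 → r ≠ 60 → r ≠ 9 → τ.reg 9 = q → τ.reg 3 = k →
      ((loop 59 3 (loop 60 9 (dbl r))).sem τ).reg r = τ.reg r * 2 ^ (k * q) := by
    intro r τ h1 h2 h3 h9 hk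
    rw [sem_loop_mul (2 ^ q) h1 fun ρ hF => key r ρ h2 h3 ?_, hk, ← pow_mul, mul_comm k q]
    rw [hF.reg 9 ?_, h9]
    simp [wr, dbl, h3.symm]
  rw [powersP, sem]
  set p₁ := seq (assign 5 (.const 0)) (loop 59 3 (assign 5 (.add (.reg 5) (.reg 4))))
  have h5 : (p₁.sem σ).reg 5 = k * d := by
    have hk' : (σ.set 5 0).reg 3 = k := by simp [hk]
    have := sem_loop (x := 59) (b := 3) (σ := σ.set 5 0)
      (p := assign 5 (.add (.reg 5) (.reg 4))) (fun m ρ => ρ.reg 5 = m * d) (by simp) (by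
        intro m ρ hm hx hF hI
        have h4 : ρ.reg 4 = d := by rw [hF.reg 4 rfl]; simp [hd]
        simp [sem, eval, hI, h4, add_mul])
    rw [hk'] at this
    exact this
  have hF₁ := frame_sem p₁ σ
  have hk₁ := (hF₁.reg 3 rfl).trans hk
  have hd₁ := (hF₁.reg 4 rfl).trans hd
  have hq₁ := (hF₁.reg 9 rfl).trans hq
  set σ₁ := p₁.sem σ
  rw [sem]
  set p₂ := seq (assign 6 (.const 1)) (loop 59 4 (dbl 6))
  have h6 : (p₂.sem σ₁).reg 6 = 2 ^ d := by
    change ((loop 59 4 (dbl 6)).sem (σ₁.set 6 1)).reg 6 = _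
    rw [sem_loop_mul 2 (by norm_num) fun ρ _ => sem_dbl 6 ρ]
    simp [hd₁]
  have hF₂ := frame_sem p₂ σ₁
  have hk₂ := (hF₂.reg 3 rfl).trans hk₁
  have hq₂ := (hF₂.reg 9 rfl).trans hq₁
  have h5₂ := (hF₂.reg 5 rfl).trans h5
  set σ₂ := p₂.sem σ₁
  rw [sem]
  set p₃ := seq (assign 7 (.const 1)) (loop 59 3 (loop 60 9 (dbl 7)))
  have h7 : (p₃.sem σ₂).reg 7 = 2 ^ (k * q) := by
    change ((loop 59 3 (loop 60 9 (dbl 7))).sem (σ₂.set 7 1)).reg 7 = _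
    rw [key2 7 _ (by norm_num) (by norm_num) (by norm_num) (by simp [hq₂]) (by simp [hk₂])]
    simp
  have hF₃ := frame_sem p₃ σ₂
  have hk₃ := (hF₃.reg 3 rfl).trans hk₂
  have hq₃ := (hF₃.reg 9 rfl).trans hq₂
  have h5₃ := (hF₃.reg 5 rfl).trans h5₂
  have h6₃ := (hF₃.reg 6 rfl).trans h6
  set σ₃ := p₃.sem σ₂
  set p₄ := seq (assign 8 (.const 1)) (loop 61 3 (loop 59 3 (loop 60 9 (dbl 8))))
  have h8 : (p₄.sem σ₃).reg 8 = (2 ^ (k * q)) ^ k := by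
    change ((loop 61 3 (loop 59 3 (loop 60 9 (dbl 8)))).sem (σ₃.set 8 1)).reg 8 = _
    rw [sem_loop_mul (2 ^ (k * q)) (by norm_num) fun ρ hF =>
      key2 8 ρ (by norm_num) (by norm_num) (by norm_num) (by rw [hF.reg 9 rfl]; simp [hq₃])
        (by rw [hF.reg 3 rfl]; simp [hk₃])]
    simp [hk₃]
  have hF₄ := frame_sem p₄ σ₃
  exact ⟨(hF₄.reg 5 rfl).trans h5₃, (hF₄.reg 6 rfl).trans h6₃, (hF₄.reg 7 rfl).trans h7, h8⟩

/-- Replace the parameter in register `3` by the number of vertices if it is larger. Without this,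
loops over the parameter would exceed the time bound on graphs of degeneracy `0`. Register `50` is
set to twice the number of vertices. -/
def capP : FP :=
  seq (ite (.lt (.reg 0) (.reg 3)) (assign 3 (.reg 0)) skip)
    (assign 50 (.add (.reg 0) (.reg 0)))

theorem sem_capP : (capP.sem σ).reg 3 = min (σ.reg 3) (σ.reg 0) ∧
    (capP.sem σ).reg 50 = σ.reg 0 + σ.reg 0 := by
  by_cases h : σ.reg 0 < σ.reg 3
  · simp [capP, sem, eval, h, h.le]
  · simp [capP, sem, eval, h, not_lt.1 h]

/-- The whole program. It consists of phases, none of which changes the bounds of its own loops. -/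
def solveP : FP :=
  seq capP (seq (seq rowsP peelP) (seq powersP (seq searchP (assign 0 (.reg 49)))))

theorem capP_ok : capP.ok = true := by decide
theorem order_ok : (seq rowsP peelP).ok = true := by decide
theorem powersP_ok : powersP.ok = true := by decide
theorem order_bounds : ∀ b ∈ (seq rowsP peelP).bounds, b = 0 ∨ b = 50 := by decide
theorem powersP_bounds : ∀ b ∈ powersP.bounds, b = 3 ∨ b = 4 ∨ b = 9 := by decide
theorem searchP_bounds : ∀ b ∈ searchP.bounds, b = 0 ∨ b = 3 ∨ b = 6 ∨ b = 8 := by decide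

end RAM.FP

/-! ### Correctness and running time -/

namespace BFVD

open RAM RAM.FP RAM.Expr

/-- After the preparatory phases the memory describes an instance with the same answer. -/
theorem exists_env {n : ℕ} (G : SimpleGraph (Fin n)) {i j k : ℕ} (hi : 1 ≤ i) (hij : i ≤ j)
    {σ₁ σ₂ : State} (h₁ : capP.sem (input G i j k) = σ₁) (h₂ : (seq rowsP peelP).sem σ₁ = σ₂) :
    ∃ I : Inst, Env I (powersP.sem σ₂) ∧ I.n = n ∧ I.k = min k n ∧ I.d ≤ degeneracy G ∧
      (I.Yes ∅ I.k ↔ IsYesInstance G i j k) ∧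
      σ₁.reg 0 = n ∧ σ₁.reg 50 = n + n ∧ σ₂.reg 3 = I.k ∧ σ₂.reg 4 = I.d ∧ σ₂.reg 9 = 6 * I.d := by
  set σ := input G i j k with hσ
  have e0 : σ.reg 0 = n := rfl
  have e1 : σ.reg 1 = i := rfl
  have e2 : σ.reg 2 = j := rfl
  have e3 : σ.reg 3 = k := rfl
  have m2 : ∀ v, σ.mem 2 v = 0 := fun v => by simp [hσ, input]
  have hF₁ := frame_sem capP σ
  obtain ⟨hk₁, h50⟩ := sem_capP (σ := σ)
  rw [h₁] at hF₁ hk₁ h50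
  rw [e3, e0] at hk₁
  rw [e0] at h50
  have h0₁ : σ₁.reg 0 = n := hF₁.reg 0 rfl
  have h1₁ : σ₁.reg 1 = i := hF₁.reg 1 rfl
  have h2₁ : σ₁.reg 2 = j := hF₁.reg 2 rfl
  rw [sem] at h₂
  have hFr := frame_sem rowsP σ₁
  have hrows := sem_rowsP h0₁
  set ρ := rowsP.sem σ₁ with hρ
  have hA : ∀ {u v}, natAdj G u v → v < n := fun h => h.2.1
  have hM : MatEnv n (natAdj G) ρ := by
    refine ⟨(hFr.reg 0 rfl).trans h0₁, fun u hu v hv => ?_⟩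
    rw [hrows u hu, hFr.mem 0 rfl, hF₁.mem 0 rfl]
    exact input_mem G i j k hu hv
  obtain ⟨⟨c, hc, hP⟩, h9⟩ := sem_peelP hM hA (exists_count_le_degeneracy G) (degeneracy_le G)
    ((hFr.reg 50 rfl).trans h50) fun v => by rw [hFr.mem 2 rfl, hF₁.mem 2 rfl]; exact m2 v
  have hFp := frame_sem peelP ρ
  have hM₂ := hM.frame hFp rfl rfl rfl
  rw [h₂] at hP h9 hFp hM₂
  have hne := hP.ne_zero hc
  let I : Inst :=
    { n := n, i := i, j := j, k := min k n, d := σ₂.reg 4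
      adj := natAdj G
      ord := σ₂.mem 2
      i_pos := hi
      j_pos := hi.trans hij
      symm := fun ⟨hu, hv, h⟩ => ⟨hv, hu, h.symm⟩
      lt := hA
      ord_ne := by
        rintro u v ⟨hu, hv, h⟩ heq
        have := hP.inj u hu v hv (hne u hu) heq
        exact G.ne_of_adj h (Fin.ext this)
      card_le := by
        intro u S hS
        rcases S.eq_empty_or_nonempty with rfl | ⟨w, hw⟩
        · simp
        · have hu : u < n := (hS w hw).1.1
          exact hP.out u hu (hne u hu) S fun w hw => ⟨(hS w hw).1, .inr (hS w hw).2⟩ }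
  have h3₂ : σ₂.reg 3 = min k n := (hFp.reg 3 rfl).trans ((hFr.reg 3 rfl).trans hk₁)
  obtain ⟨p5, p6, p7, p8⟩ := sem_powersP h3₂ (rfl : σ₂.reg 4 = I.d) h9
  have hFw := frame_sem powersP σ₂
  refine ⟨I, ?_, rfl, rfl, hP.d_le, (isYesInstance_iff (I := I) rfl rfl).symm, h0₁, h50, h3₂, rfl,
    h9⟩
  constructor
  · exact (hFw.reg 0 rfl).trans hM₂.reg_zero
  · exact (hFw.reg 1 rfl).trans ((hFp.reg 1 rfl).trans ((hFr.reg 1 rfl).trans h1₁))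
  · exact (hFw.reg 2 rfl).trans ((hFp.reg 2 rfl).trans ((hFr.reg 2 rfl).trans h2₁))
  · exact (hFw.reg 3 rfl).trans h3₂
  · exact hFw.reg 4 rfl
  · exact p5
  · exact p6
  · exact p7
  · exact p8
  · rw [hFw.mem 0 rfl, hFw.mem 1 rfl]
    exact hM₂.adj
  · intro u _
    rw [hFw.mem 2 rfl]

open Classical in
/-- The program computes the answer. Its running time is polynomial in a number that exceeds all
its loop bounds; the largest one is the number `base ^ k` of branches. -/
theorem solveP_spec {n : ℕ} (G : SimpleGraph (Fin n)) {i j k : ℕ} (hi : 1 ≤ i) (hij : i ≤ j)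
    (hk : 1 ≤ k) :
    solveP.RunsIn (6 * (2 ^ (6 * (degeneracy G * k ^ 2)) * (n + 1))) (input G i j k) ∧
      (solveP.sem (input G i j k)).reg 0 = if IsYesInstance G i j k then 1 else 0 := by
  set σ := input G i j k
  obtain ⟨I, hE, hn, hIk, hd, hyes, h0, h50, h3, h4, h9⟩ := exists_env G (k := k) hi hij rfl rfl
  set δ := degeneracy G
  set σ₁ := capP.sem σ
  set σ₂ := (seq rowsP peelP).sem σ₁
  set σ₃ := powersP.sem σ₂
  set W := 2 ^ (6 * (δ * k ^ 2)) with hW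
  have hW1 : 1 ≤ W := Nat.one_le_two_pow
  have hWn : n + 1 ≤ W * (n + 1) := Nat.le_mul_of_pos_left _ hW1
  have hWW : W ≤ W * (n + 1) := Nat.le_mul_of_pos_right _ (Nat.succ_pos n)
  have hδn : δ ≤ n := degeneracy_le G
  have hkn : I.k ≤ n := hIk ▸ min_le_right _ _
  have hkk : I.k ≤ k := hIk ▸ min_le_left _ _
  -- This is where `1 ≤ k` is needed.
  have hp6 : 2 ^ I.d ≤ W := by
    refine Nat.pow_le_pow_right (by norm_num) ?_
    have : δ * 1 ≤ δ * k ^ 2 := Nat.mul_le_mul_left _ (Nat.one_le_pow _ _ hk)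
    omega
  have hp8 : I.base ^ I.k ≤ W := by
    rw [Inst.base, ← pow_mul]
    refine Nat.pow_le_pow_right (by norm_num) ?_
    calc I.k * (6 * I.d) * I.k ≤ k * (6 * δ) * k := by gcongr
      _ = 6 * (δ * k ^ 2) := by ring
  set N := 6 * (W * (n + 1)) with hN
  have hN1 : 1 ≤ N := by omega
  constructor
  · refine RunsIn.seq hN1 (runsIn capP_ok hN1 fun b hb => by simp [capP, bounds] at hb) ?_
    refine RunsIn.seq hN1 (runsIn order_ok hN1 fun b hb => ?_) ?_
    · change σ₁.reg b + 1 ≤ N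
      rcases order_bounds b hb with rfl | rfl <;> omega
    refine RunsIn.seq hN1 (runsIn powersP_ok hN1 fun b hb => ?_) ?_
    · change σ₂.reg b + 1 ≤ N
      rcases powersP_bounds b hb with rfl | rfl | rfl <;> omega
    refine RunsIn.seq hN1 (runsIn searchP_ok hN1 fun b hb => ?_) ?_
    · change σ₃.reg b + 1 ≤ N
      have g0 := hE.n
      have g3 := hE.k
      have g6 := hE.two_pow
      have g8 := hE.base_pow
      rcases searchP_bounds b hb with rfl | rfl | rfl | rfl <;> omega
    · exact runsIn rfl hN1 fun b hb => by simp [bounds] at hb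
  · rw [solveP, sem_seq capP, sem_seq (seq rowsP peelP), sem_seq powersP, sem_seq searchP,
      sem_assign, State.set_reg, if_pos rfl, eval, sem_searchP hE]
    simp only [hyes]

theorem solvesInTime_solveP : SolvesInTime solveP.compile fun {n} G _ _ k =>
    solveP.size * 6 ^ solveP.depth * 2 ^ (6 * solveP.depth * (degeneracy G * k ^ 2)) *
      (n + 1) ^ solveP.depth := by
  intro n G i j k hi hij hk
  obtain ⟨⟨t, ht, he⟩, hans⟩ := solveP_spec G hi hij hk
  refine ⟨_, t, he, ht.trans (le_of_eq ?_), hans⟩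
  rw [mul_pow, mul_pow, ← pow_mul]
  have : 6 * (degeneracy G * k ^ 2) * solveP.depth =
      6 * solveP.depth * (degeneracy G * k ^ 2) := by ring
  rw [this]
  simp only [mul_assoc]

theorem SolvesInTime.mono {p : Program} {S T : {n : ℕ} → SimpleGraph (Fin n) → (i j k : ℕ) → ℕ}
    (h : SolvesInTime p S)
    (hST : ∀ {n : ℕ} (G : SimpleGraph (Fin n)) (i j k : ℕ), S G i j k ≤ T G i j k) :
    SolvesInTime p T := by
  intro n G i j k hi hij hk
  obtain ⟨τ, t, he, ht, hans⟩ := h n G i j k hi hij hk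
  exact ⟨τ, t, he, ht.trans (hST G i j k), hans⟩

theorem computable_bound (A C : ℕ) : Computable fun s : ℕ => A * 2 ^ (C * (s * s * s)) := by
  have hpow : Primrec₂ fun a b : ℕ => a ^ b := Primrec₂.unpaired'.1 Nat.Primrec.pow
  have hid : Primrec fun s : ℕ => s := Primrec.id
  have hcube : Primrec fun s : ℕ => s * s * s :=
    Primrec.nat_mul.comp (Primrec.nat_mul.comp hid hid) hid
  exact (Primrec.nat_mul.comp (Primrec.const A) (hpow.comp (Primrec.const 2)
    (Primrec.nat_mul.comp (Primrec.const C) hcube))).to_comp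

end BFVD

theorem mainTheorem1 :
    (∃ (p : RAM.Program) (A C c : ℕ),
      BFVD.SolvesInTime p (fun {n} G _ _ k =>
        A * 2 ^ (C * (BFVD.degeneracy G * k ^ 2)) * (n + 1) ^ c)) ∧
    (∃ (p : RAM.Program) (f : ℕ → ℕ) (c : ℕ), Computable f ∧
      BFVD.SolvesInTime p (fun {n} G _ _ k =>
        f (k + BFVD.degeneracy G) * (n + 1) ^ c)) := by
  refine ⟨⟨_, _, _, _, BFVD.solvesInTime_solveP⟩, ⟨_, _, RAM.FP.solveP.depth, BFVD.computable_bound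
    (RAM.FP.solveP.size * 6 ^ RAM.FP.solveP.depth) (6 * RAM.FP.solveP.depth),
    BFVD.solvesInTime_solveP.mono fun {n} G _ _ k => ?_⟩⟩
  refine Nat.mul_le_mul_right _ (Nat.mul_le_mul_left _ (Nat.pow_le_pow_right (by norm_num)
    (Nat.mul_le_mul_left _ ?_)))
  calc BFVD.degeneracy G * k ^ 2 = BFVD.degeneracy G * k * k := by ring
    _ ≤ _ := by gcongr <;> omega
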